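/- Let $\Omega\subset\mathbb R^2$ be an open set whose boundary $\partial\Omega$ is non-empty, compact and of class $C^3$ (with $\Omega$ locally on one side of $\partial\Omega$; $\Omega$ may be bounded or unbounded, e.g. an interior or an exterior domain). Let $\mathbf A_0(x_1,x_2)=(-x_2,0)$. For $h>0$ and $\zeta>0$ let $P_{h,\zeta}=-(h\nabla-i\zeta\mathbf A_0)^2$ be the self-adjoint operator in $L^2(\Omega)$ associated with the closed, semi-bounded quadratic form $$q_{h,\zeta}(u)=\int_\Omega|(h\nabla-i\zeta\mathbf A_0)u|^2\,dx-h^{3/2}\int_{\partial\Omega}|u|^2\,ds(x),$$ with form domain $\{u\in L^2(\Omega):(h\nabla-i\zeta\mathbf A_0)u\in L^2(\Omega)\}$, where $ds$ is the arc length on $\partial\Omega$ and $u$ is restricted to $\partial\Omega$ in the sense of traces. Let $\lambda_1(h,\zeta)=\inf\sigma(P_{h,\zeta})$ be the infimum of its spectrum. An $L^2$-normalized ground state of $P_{h,\zeta}$ is a function $u$ in the domain of $P_{h,\zeta}$ with $P_{h,\zeta}u=\lambda_1(h,\zeta)u$ and $\|u\|_{L^2(\Omega)}=1$. **Theorem.**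 Let $0<c_1<c_2$, $\epsilon>0$ and $\alpha<1$. There exist constants $C>0$ and $h_0\in(0,1)$ (depending only on $\Omega,c_1,c_2,\epsilon,\alpha$) such that, if $h\in(0,h_0)$, $\zeta\in(c_1h^\epsilon,c_2h^\epsilon)$ and $u_{h,\zeta}$ is an $L^2$-normalized ground state of $P_{h,\zeta}$, then $$\int_\Omega\Big(|u_{h,\zeta}(x)|^2+h^{-1}|(h\nabla-i\zeta\mathbf A_0)u_{h,\zeta}(x)|^2\Big)\exp\Big(\frac{2\alpha\,\mathrm{dist}(x,\partial\Omega)}{h^{1/2}}\Big)\,dx\le C.$$ -/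

import Mathlib

open MeasureTheory Filter Topology
open scoped ENNReal ContDiff

noncomputable section

namespace RobinMagnetic

/-- The Euclidean plane `ℝ²`. -/
abbrev Plane : Type := EuclideanSpace ℝ (Fin 2)

/-- An open set of the plane whose boundary is non-empty, compact and of class `C³`: near each of
its boundary points the set is a sublevel set `{ψ < 0}` of a `C³` function with non-zero
differential (so that the set lies locally on one side of its boundary). The set may be bounded or
unbounded, and it need not be connected. -/
structure IsC3Domain (Ω : Set Plane) : Prop where
  isOpen : IsOpen Ω
  frontier_nonempty : (frontier Ω).Nonempty
  isCompact_frontier : IsCompact (frontier Ω)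
  smooth : ∀ p ∈ frontier Ω, ∃ (U : Set Plane) (ψ : Plane → ℝ),
    IsOpen U ∧ p ∈ U ∧ ContDiffOn ℝ 3 ψ U ∧ fderiv ℝ ψ p ≠ 0 ∧ Ω ∩ U = {x ∈ U | ψ x < 0}

/-- The magnetic potential `A₀(x₁, x₂) = (-x₂, 0)`, of constant magnetic field `1`. -/
def A₀ (x : Plane) : Plane := !₂[-x 1, 0]

/-- The complex Hilbert space `L²(Ω)`. -/
abbrev L2 (Ω : Set Plane) : Type := Lp ℂ 2 (volume.restrict Ω)

/-- Arc length `ds` on the boundary: the one-dimensional Hausdorff measure on `∂Ω`. -/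
def arcLength (Ω : Set Plane) : Measure Plane := (μH[1] : Measure Plane).restrict (frontier Ω)

/-- The complex Hilbert space `L²(∂Ω)`. -/
abbrev L2Boundary (Ω : Set Plane) : Type := Lp ℂ 2 (arcLength Ω)

/-- The classical partial derivative `∂ⱼφ`. -/
def partialDeriv (φ : Plane → ℂ) (j : Fin 2) (x : Plane) : ℂ :=
  fderiv ℝ φ x (EuclideanSpace.single j 1)

/-- The `j`-th component of `(h∇ - iζA₀)φ`, for a differentiable function `φ`. -/
def magneticGrad (h ζ : ℝ) (φ : Plane → ℂ) (j : Fin 2) (x : Plane) : ℂ :=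
  (h : ℂ) * partialDeriv φ j x - Complex.I * (ζ : ℂ) * ((A₀ x j : ℝ) : ℂ) * φ x

/-- `u ∈ L²(Ω)` belongs to the magnetic Sobolev space
`H¹(Ω) = {u ∈ L²(Ω) : (h∇ - iζA₀)u ∈ L²(Ω)}`, with `(h∇ - iζA₀)u = G` in the sense of
distributions on `Ω`. -/
def IsMagneticGrad (Ω : Set Plane) (h ζ : ℝ) (u : L2 Ω) (G : Fin 2 → L2 Ω) : Prop :=
  ∀ φ : Plane → ℂ, ContDiff ℝ ∞ φ → HasCompactSupport φ → tsupport φ ⊆ Ω → ∀ j : Fin 2,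
    ∫ x in Ω, G j x * φ x =
      - ∫ x in Ω, u x *
          ((h : ℂ) * partialDeriv φ j x + Complex.I * (ζ : ℂ) * ((A₀ x j : ℝ) : ℂ) * φ x)

/-- `g ∈ L²(∂Ω)` is the trace on `∂Ω` of the function `u` of the magnetic Sobolev space, whose
magnetic gradient is `G`: there are smooth compactly supported functions on the plane whose
restrictions to `Ω` tend to `u` in the norm of the magnetic Sobolev space and whose restrictions to
`∂Ω` tend to `g` in `L²(∂Ω)`. For `Ω` with compact `C³` boundary these restrictions are dense in
the magnetic Sobolev space, and restriction to `∂Ω` is continuous from its norm to `L²(∂Ω)`, so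
every `u` in the magnetic Sobolev space has exactly one trace: the form domain of `q` below is the
whole magnetic Sobolev space. -/
def IsTrace (Ω : Set Plane) (h ζ : ℝ) (u : L2 Ω) (G : Fin 2 → L2 Ω) (g : L2Boundary Ω) : Prop :=
  ∃ φ : ℕ → Plane → ℂ,
    (∀ n, ContDiff ℝ ∞ (φ n) ∧ HasCompactSupport (φ n)) ∧
    Tendsto (fun n => eLpNorm (fun x => φ n x - u x) 2 (volume.restrict Ω)) atTop (𝓝 0) ∧
    (∀ j : Fin 2, Tendsto (fun n =>
      eLpNorm (fun x => magneticGrad h ζ (φ n) j x - G j x) 2 (volume.restrict Ω)) atTop (𝓝 0)) ∧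
    Tendsto (fun n => eLpNorm (fun x => φ n x - g x) 2 (arcLength Ω)) atTop (𝓝 0)

/-- The sesquilinear form `q(u, v)` whose quadratic form is
`q(u) = ∫_Ω |(h∇ - iζA₀)u|² dx - h^{3/2} ∫_{∂Ω} |u|² ds`, in terms of the magnetic gradients
`Gu`, `Gv` and of the traces `gu`, `gv`. It is linear in `u` and conjugate-linear in `v`. -/
def robinForm {Ω : Set Plane} (h : ℝ) (Gu : Fin 2 → L2 Ω) (gu : L2Boundary Ω)
    (Gv : Fin 2 → L2 Ω) (gv : L2Boundary Ω) : ℂ :=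
  ∑ j : Fin 2, inner ℂ (Gv j) (Gu j) - ((h ^ (3 / 2 : ℝ) : ℝ) : ℂ) * inner ℂ gv gu

/-- The operator `P_{h,ζ} = -(h∇ - iζA₀)²` in `L²(Ω)` with the magnetic Robin condition, namely the
self-adjoint operator associated with the quadratic form `q`, given by its graph:
`RobinLaplacian Ω h ζ u f` says that `u` is in the domain of `P_{h,ζ}` and `P_{h,ζ} u = f`, that is,
`u` is in the form domain and `q(u, v) = ⟨f, v⟩` for all `v` in the form domain. -/
def RobinLaplacian (Ω : Set Plane) (h ζ : ℝ) (u f : L2 Ω) : Prop :=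
  ∃ (Gu : Fin 2 → L2 Ω) (gu : L2Boundary Ω),
    IsMagneticGrad Ω h ζ u Gu ∧ IsTrace Ω h ζ u Gu gu ∧
    ∀ (v : L2 Ω) (Gv : Fin 2 → L2 Ω) (gv : L2Boundary Ω),
      IsMagneticGrad Ω h ζ v Gv → IsTrace Ω h ζ v Gv gv →
        robinForm h Gu gu Gv gv = inner ℂ v f

/-- The spectrum of an unbounded operator `T` in a complex Hilbert space, given by its graph
(`T u f` means that `u` is in the domain and `T u = f`): the complex numbers `z` for which `T - z`
has no bounded everywhere defined inverse `R`. -/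
def unboundedSpectrum {H : Type*} [NormedAddCommGroup H] [InnerProductSpace ℂ H]
    (T : H → H → Prop) : Set ℂ :=
  {z | ¬ ∃ R : H →L[ℂ] H,
    (∀ w : H, T (R w) (w + z • R w)) ∧ (∀ u f : H, T u f → R (f - z • u) = u)}

/-- `λ` is the ground state energy `λ₁(h,ζ) = inf σ(P_{h,ζ})` (the spectrum is a subset of the real
line, as `P_{h,ζ}` is self-adjoint). -/
def IsGroundStateEnergy (Ω : Set Plane) (h ζ lam : ℝ) : Prop :=
  IsGLB {t : ℝ | (t : ℂ) ∈ unboundedSpectrum (RobinLaplacian Ω h ζ)} lam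

/-- `u` is an `L²`-normalized ground state of `P_{h,ζ}`: a normalized eigenfunction for the
eigenvalue `λ₁(h,ζ)`. -/
def IsNormalizedGroundState (Ω : Set Plane) (h ζ : ℝ) (u : L2 Ω) : Prop :=
  ‖u‖ = 1 ∧ ∃ lam : ℝ, IsGroundStateEnergy Ω h ζ lam ∧ RobinLaplacian Ω h ζ u ((lam : ℂ) • u)

end RobinMagnetic

end

/-!
# Decay of the ground states of a magnetic Robin Laplacian

The weight in the theorem is `exp (2α d / √h)` with `d = dist(·, ∂Ω)` and `α < 1`. That such a decay
rate is possible comes from two facts about the energy, which at leading order do not see the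
magnetic field, because `ζ = O(h^ε)` is small.

* Away from the boundary the form `q` is non-negative: all of the negative energy comes from the
  boundary term.
* The ground state energy satisfies `λ ≤ -(1 - o(1)) h` (`IsC3Domain.groundStateEnergy_le`). At the
  scale `√h` the Robin problem in a half plane has the ground state `e^{-t/√h}`, with `t` the
  distance to the boundary, and the energy `-h`. A cutoff of this function at one boundary point,
  multiplied by the phase `e^{iζ ⟪A₀(p), x⟫ / h}` which gauges away the potential at that point, is
  the trial function. It needs no more than a first order approximation of the boundary.

So a ground state lies by almost `h` below the threshold `0`, and the Agmon estimate gives the rate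
`√((1 - o(1)) h) / h`, which exceeds `α / √h`. In detail, testing the eigenvalue equation with `w² u`
gives the Agmon identity `q(w u) = λ ‖w u‖² + h² ‖u ∇w‖²` (`agmon_identity`). The weight
`w = sinh (α d / √h)` vanishes on the boundary, so the boundary term disappears, and
`h² |∇w|² ≤ α² h (1 + w²)` bounds `(-λ - α² h) ‖w u‖²` by `α² h ‖u‖²`. The magnetic gradient is then
bounded by means of the weight `cosh (α d / √h)` (`norm_cosh_le`), since the boundary term is form
bounded with a small constant, uniformly in the magnetic field (`IsC3Domain.exists_form_bound`). The
function `d` is here a smooth bounded substitute of the distance, and the theorem follows by monotone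
convergence.

Three ingredients have to be built.

* The form domain is the closure `formDomain` of the triples of a test function, its magnetic
  gradient and its boundary values, in a Hilbert space of triples. A bound of the form by the bottom
  of the spectrum (`IsGroundStateEnergy.le_form`) is derived without the spectral theorem for
  unbounded operators: the resolvent `R = (P + M)⁻¹` is a bounded positive operator, so `‖R‖` lies in
  its spectrum, and `‖R‖⁻¹ - M` lies in the spectrum of `P`.
* Near a boundary point the domain is a sublevel set of a function which is arbitrarily close to a
  linear one (`IsFlatChart`). The projection to the tangent then covers an interval, does not
  increase distances, and has a Lipschitz inverse on the boundary. This bounds the one-dimensional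
  Hausdorff measure on the boundary from both sides, without an area formula, and the bound from
  below is sharp enough for the energy of the trial function.
* The trace inequality (`IsC3Domain.exists_trace_const`) follows from the fundamental theorem of
  calculus along the normal direction and the diamagnetic inequality.
-/

namespace RobinMagnetic

/-! ### The bottom of the spectrum and the quadratic form -/

section Spectral

theorem inner_self_re_eq {E : Type*} [NormedAddCommGroup E] [InnerProductSpace ℂ E] (v : E) :
    (inner ℂ v v).re = ‖v‖ ^ 2 :=
  inner_self_eq_norm_sq (𝕜 := ℂ) v

variable {H V : Type*} [NormedAddCommGroup H] [InnerProductSpace ℂ H]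
  [NormedAddCommGroup V] [InnerProductSpace ℂ V]

/-- If the resolvent `R₀ = (T + M)⁻¹` is a bounded operator and `r ≠ 0` lies in its spectrum, then
`r⁻¹ - M` lies in the spectrum of `T`. -/
theorem inv_sub_mem_unboundedSpectrum {T : H → H → Prop} {R₀ : H →L[ℂ] H} {M : ℝ}
    (h₁ : ∀ w, T (R₀ w) (w - (M : ℂ) • R₀ w)) (h₂ : ∀ u f, T u f → R₀ (f + (M : ℂ) • u) = u)
    {r : ℝ} (hr : r ≠ 0) (hspec : r ∈ spectrum ℝ R₀) :
    ((r⁻¹ - M : ℝ) : ℂ) ∈ unboundedSpectrum T := by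
  rintro ⟨R, hR₁, hR₂⟩
  have hrC : (r : ℂ) ≠ 0 := by exact_mod_cast hr
  have e₁ : ∀ w, R₀ w + (r⁻¹ : ℂ) • R₀ (R w) = R w := by
    intro w
    have := h₂ _ _ (hR₁ w)
    rw [← map_smul, ← map_add]
    convert this using 2
    push_cast
    module
  have e₂ : ∀ w, R w - (r⁻¹ : ℂ) • R (R₀ w) = R₀ w := by
    intro w
    have := hR₂ _ _ (h₁ w)
    rw [← map_smul, ← map_sub]
    convert this using 2
    push_cast
    module
  refine hspec ?_
  -- the inverse of `r - R₀` is `r⁻¹ (1 + r⁻¹ R)`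
  refine ⟨⟨algebraMap ℝ (H →L[ℂ] H) r - R₀, (r⁻¹ : ℂ) • (1 + (r⁻¹ : ℂ) • R), ?_, ?_⟩, rfl⟩
  · ext w
    change (r : ℝ) • (1 : H →L[ℂ] H) ((r⁻¹ : ℂ) • (w + (r⁻¹ : ℂ) • R w))
      - R₀ ((r⁻¹ : ℂ) • (w + (r⁻¹ : ℂ) • R w)) = w
    rw [map_smul R₀, map_add, map_smul R₀, e₁, one_apply_eq_self, ← Complex.coe_smul, smul_smul,
      mul_inv_cancel₀ hrC, one_smul, add_sub_cancel_right]
  · ext w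
    change (r⁻¹ : ℂ) • ((r • w - R₀ w) + (r⁻¹ : ℂ) • R (r • w - R₀ w)) = w
    rw [← Complex.coe_smul, map_sub, map_smul, smul_sub, smul_smul, inv_mul_cancel₀ hrC, one_smul,
      sub_add, sub_eq_iff_eq_add.2 (sub_eq_iff_eq_add.1 (e₂ w)), smul_sub, smul_smul,
      inv_mul_cancel₀ hrC, one_smul]
    simp

/-- The variational characterization of the bottom of the spectrum, as an inequality: if a hermitian
form `⟪y, T x⟫` on `V` is coercive up to a multiple of `‖J x‖²`, every lower bound of the real
spectrum of the operator which it induces in `H` is a lower bound of the form. -/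
theorem le_form_of_mem_lowerBounds_spectrum [CompleteSpace H] [CompleteSpace V]
    (T : V →L[ℂ] V) (hT : IsSelfAdjoint T) (J : V →L[ℂ] H) {M c : ℝ} (hc : 0 < c)
    (hcoer : ∀ x, c * ‖x‖ ^ 2 ≤ (inner ℂ x (T x)).re + M * ‖J x‖ ^ 2) {lam : ℝ}
    (hlam : lam ∈ lowerBounds {t : ℝ | (t : ℂ) ∈ unboundedSpectrum
      (fun u f : H => ∃ x, J x = u ∧ ∀ y, inner ℂ y (T x) = inner ℂ (J y) f)}) (x : V) :
    lam * ‖J x‖ ^ 2 ≤ (inner ℂ x (T x)).re := by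
  set S : V →L[ℂ] V := T + (M : ℂ) • (J.adjoint ∘L J) with hS
  have hSx : ∀ x y, inner ℂ y (S x) = inner ℂ y (T x) + M * inner ℂ (J y) (J x) := by
    intro x y
    simp [hS, ContinuousLinearMap.adjoint_inner_right]
  have hSre : ∀ x, (inner ℂ x (S x)).re = (inner ℂ x (T x)).re + M * ‖J x‖ ^ 2 := by
    intro x
    rw [hSx, inner_self_eq_norm_sq_to_K]
    simp [← Complex.ofReal_pow]
  have hSc : ∀ x, c * ‖x‖ ^ 2 ≤ (inner ℂ x (S x)).re := fun x => by rw [hSre]; exact hcoer x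
  have hSsa : ∀ x y, inner ℂ (S x) y = inner ℂ x (S y) := by
    intro x y
    have h1 : inner ℂ (T x) y = inner ℂ x (T y) := by
      rw [← ContinuousLinearMap.adjoint_inner_right]
      rw [hT.adjoint_eq]
    rw [hSx, ← h1, ← inner_conj_symm, hSx, map_add, inner_conj_symm, map_mul, inner_conj_symm,
      Complex.conj_ofReal]
  obtain ⟨Su, hSu⟩ : IsUnit S := by
    refine ContinuousLinearMap.isUnit_of_forall_le_norm_inner_map S (c := ⟨c, hc.le⟩) hc fun x => ?_
    rw [hSsa, mul_comm]
    exact (hSc x).trans ((le_abs_self _).trans (Complex.abs_re_le_norm _))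
  set Q : V →L[ℂ] V := ((Su⁻¹ : (V →L[ℂ] V)ˣ) : V →L[ℂ] V) with hQ
  have hSQ : ∀ x, S (Q x) = x := fun x => by
    rw [← hSu, hQ, ← mul_apply_eq_comp, Units.mul_inv, one_apply_eq_self]
  have hQS : ∀ x, Q (S x) = x := fun x => by
    rw [← hSu, hQ, ← mul_apply_eq_comp, Units.inv_mul, one_apply_eq_self]
  set R₀ : H →L[ℂ] H := J ∘L Q ∘L J.adjoint with hR₀
  have hR₀in : ∀ f x, inner ℂ (J x) f = inner ℂ x (S (Q (J.adjoint f))) := by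
    intro f x
    rw [hSQ, ContinuousLinearMap.adjoint_inner_right]
  have hR₀pos : 0 ≤ R₀ := by
    rw [ContinuousLinearMap.nonneg_iff_isPositive, ContinuousLinearMap.isPositive_def']
    constructor
    · rw [ContinuousLinearMap.isSelfAdjoint_iff_isSymmetric]
      intro f g
      change inner ℂ (J (Q (J.adjoint f))) g = inner ℂ f (J (Q (J.adjoint g)))
      rw [hR₀in, ← inner_conj_symm f, hR₀in, inner_conj_symm, hSsa]
    · intro f
      change 0 ≤ (inner ℂ (J (Q (J.adjoint f))) f).re
      rw [hR₀in]
      exact le_trans (by positivity) (hSc _)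
  -- Cauchy-Schwarz for the positive form of `S`, as a negative discriminant
  have hCS : ∀ x y, (inner ℂ x (S y)).re ^ 2 ≤ (inner ℂ y (S y)).re * (inner ℂ x (S x)).re := by
    intro x y
    have key := discrim_le_zero (a := (inner ℂ y (S y)).re) (b := 2 * (inner ℂ x (S y)).re)
      (c := (inner ℂ x (S x)).re) (fun t => by
        have h := (by positivity : 0 ≤ c * ‖x + (t : ℂ) • y‖ ^ 2).trans (hSc (x + (t : ℂ) • y))
        have hs : (inner ℂ y (S x)).re = (inner ℂ x (S y)).re := by
          rw [← hSsa, ← inner_conj_symm, Complex.conj_re]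
        simp only [map_add, map_smul, inner_add_left, inner_add_right, inner_smul_left,
          inner_smul_right, Complex.add_re, Complex.conj_ofReal, Complex.re_ofReal_mul, hs] at h
        linarith)
    rw [discrim] at key
    linarith
  -- with `y = S⁻¹ J* J x`, Cauchy-Schwarz bounds `‖J x‖⁴ = ⟪x, S y⟫²`
  have hbound : ‖J x‖ ^ 2 ≤ ‖R₀‖ * (inner ℂ x (S x)).re := by
    by_cases hx : J x = 0
    · rw [hx, norm_zero]
      have := (mul_nonneg hc.le (sq_nonneg ‖x‖)).trans (hSc x)
      simpa using mul_nonneg (norm_nonneg R₀) this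
    have hx' : 0 < ‖J x‖ := norm_pos_iff.2 hx
    have h1 := hCS x (Q (J.adjoint (J x)))
    have h2 : (inner ℂ (J (Q (J.adjoint (J x)))) (J x)).re ≤ ‖R₀‖ * ‖J x‖ * ‖J x‖ := by
      refine (le_abs_self _).trans
        ((Complex.abs_re_le_norm _).trans ((norm_inner_le_norm _ _).trans ?_))
      gcongr
      exact R₀.le_opNorm (J x)
    rw [← hR₀in, ← hR₀in] at h1
    have h3 : 0 ≤ (inner ℂ x (S x)).re := (by positivity : 0 ≤ c * ‖x‖ ^ 2).trans (hSc x)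
    have h4 := h1.trans (mul_le_mul_of_nonneg_right h2 h3)
    rw [inner_self_re_eq] at h4
    have h5 : 0 < ‖J x‖ ^ 2 := by positivity
    refine le_of_mul_le_mul_left ?_ h5
    nlinarith
  have hSx0 : 0 ≤ (inner ℂ x (S x)).re := (by positivity : 0 ≤ c * ‖x‖ ^ 2).trans (hSc x)
  rw [hSre] at hbound hSx0
  rcases le_or_gt (lam + M) 0 with hM | hM
  · nlinarith [sq_nonneg ‖J x‖, mul_nonneg (neg_nonneg.2 hM) (sq_nonneg ‖J x‖)]
  rcases eq_or_ne R₀ 0 with h0 | h0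
  · rw [h0, norm_zero, zero_mul] at hbound
    have : ‖J x‖ ^ 2 = 0 := le_antisymm hbound (sq_nonneg _)
    rw [this] at hSx0 ⊢
    linarith
  have hr : 0 < ‖R₀‖ := norm_pos_iff.2 h0
  have : Nontrivial (H →L[ℂ] H) := ⟨⟨R₀, 0, h0⟩⟩
  have hspec := CStarAlgebra.norm_mem_spectrum_of_nonneg hR₀pos
  have hl : lam ≤ ‖R₀‖⁻¹ - M := by
    refine hlam (Set.mem_ofPred_eq ▸ inv_sub_mem_unboundedSpectrum (R₀ := R₀) ?_ ?_ hr.ne' hspec)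
    · intro w
      refine ⟨Q (J.adjoint w), rfl, fun y => ?_⟩
      have := hSx (Q (J.adjoint w)) y
      rw [← hR₀in] at this
      rw [inner_sub_right, inner_smul_right, this]
      change _ = _ - (M : ℂ) * inner ℂ (J y) (J (Q (J.adjoint w)))
      ring
    · rintro u f ⟨y, rfl, hy⟩
      have : S y = J.adjoint (f + (M : ℂ) • J y) := by
        refine ext_inner_left ℂ fun z => ?_
        rw [hSx, hy, ContinuousLinearMap.adjoint_inner_right, inner_add_right, inner_smul_right]
      change J (Q (J.adjoint _)) = _
      rw [← this, hQS]
  have h6 : (lam + M) * ‖R₀‖ ≤ 1 := by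
    have : lam + M ≤ ‖R₀‖⁻¹ := by linarith
    calc (lam + M) * ‖R₀‖ ≤ ‖R₀‖⁻¹ * ‖R₀‖ := by gcongr
      _ = 1 := inv_mul_cancel₀ hr.ne'
  nlinarith [mul_le_mul_of_nonneg_left hbound hM.le]

/-- The same inequality for the form `∑ⱼ ⟪Dⱼ y, Dⱼ x⟫ - κ ⟪B y, B x⟫`. -/
theorem le_sum_sub_of_mem_lowerBounds_spectrum [CompleteSpace H] [CompleteSpace V] {K : Type*}
    [NormedAddCommGroup K] [InnerProductSpace ℂ K] [CompleteSpace K] {ι : Type*} [Fintype ι]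
    (J : V →L[ℂ] H) (D : ι → V →L[ℂ] H) (B : V →L[ℂ] K) {κ M c : ℝ} (hc : 0 < c)
    (hcoer : ∀ x, c * ‖x‖ ^ 2 ≤ ∑ j, ‖D j x‖ ^ 2 - κ * ‖B x‖ ^ 2 + M * ‖J x‖ ^ 2) {lam : ℝ}
    (hlam : lam ∈ lowerBounds {t : ℝ | (t : ℂ) ∈ unboundedSpectrum
      (fun u f : H => ∃ x, J x = u ∧
        ∀ y, ∑ j, inner ℂ (D j y) (D j x) - κ * inner ℂ (B y) (B x) = inner ℂ (J y) f)}) (x : V) :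
    lam * ‖J x‖ ^ 2 ≤ ∑ j, ‖D j x‖ ^ 2 - κ * ‖B x‖ ^ 2 := by
  set T : V →L[ℂ] V := (∑ j, (D j).adjoint ∘L D j) - (κ : ℂ) • (B.adjoint ∘L B) with hT
  have hTx : ∀ y z, inner ℂ z (T y) =
      ∑ j, inner ℂ (D j z) (D j y) - κ * inner ℂ (B z) (B y) := by
    intro y z
    simp only [hT, sub_apply, sum_apply, ContinuousLinearMap.comp_apply, smul_apply,
      inner_sub_right, inner_sum, inner_smul_right, ContinuousLinearMap.adjoint_inner_right]
  have hTsa : IsSelfAdjoint T := by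
    rw [ContinuousLinearMap.isSelfAdjoint_iff_isSymmetric]
    intro y z
    change inner ℂ (T y) z = inner ℂ y (T z)
    rw [← inner_conj_symm, hTx, hTx, map_sub, map_sum, map_mul, Complex.conj_ofReal,
      inner_conj_symm]
    simp_rw [inner_conj_symm]
  have hTre : ∀ y, (inner ℂ y (T y)).re = ∑ j, ‖D j y‖ ^ 2 - κ * ‖B y‖ ^ 2 := fun y => by
    rw [hTx, Complex.sub_re, Complex.re_sum, Complex.re_ofReal_mul, inner_self_re_eq]
    simp_rw [inner_self_re_eq]
  have := le_form_of_mem_lowerBounds_spectrum T hTsa J hc (fun y => by rw [hTre]; exact hcoer y)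
    (lam := lam) (by simp_rw [hTx]; exact hlam) x
  rwa [hTre] at this

end Spectral

/-! ### Multiplication operators on `L²` -/

section Multiplication

variable {μ : Measure Plane}

theorem memLp_bounded_mul (w : BoundedContinuousFunction Plane ℝ) (f : Lp ℂ 2 μ) :
    MemLp (fun x => (w x : ℂ) * f x) 2 μ := by
  refine MemLp.of_le_mul (c := ‖w‖) (Lp.memLp f) ?_ (Eventually.of_forall fun x => ?_)
  · exact (Complex.continuous_ofReal.comp w.continuous).aestronglyMeasurable.mul
      (Lp.memLp f).aestronglyMeasurable
  · rw [norm_mul, Complex.norm_real]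
    gcongr
    exact w.norm_coe_le_norm x

/-- Multiplication by a bounded continuous real function, as a bounded operator on `L²(μ)`. -/
noncomputable def mulOp (μ : Measure Plane) (w : BoundedContinuousFunction Plane ℝ) :
    Lp ℂ 2 μ →L[ℂ] Lp ℂ 2 μ :=
  LinearMap.mkContinuous
    { toFun := fun f => (memLp_bounded_mul w f).toLp _
      map_add' := fun f g => by
        rw [← MemLp.toLp_add]
        refine MemLp.toLp_congr _ _ ?_
        filter_upwards [Lp.coeFn_add f g] with x hx
        rw [hx, Pi.add_apply, Pi.add_apply, mul_add]
      map_smul' := fun c f => by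
        rw [RingHom.id_apply, ← MemLp.toLp_const_smul]
        refine MemLp.toLp_congr _ _ ?_
        filter_upwards [Lp.coeFn_smul c f] with x hx
        simp only [hx, Pi.smul_apply, smul_eq_mul]
        ring }
    ‖w‖ fun f => by
      refine Lp.norm_le_mul_norm_of_ae_le_mul ?_
      filter_upwards [(memLp_bounded_mul w f).coeFn_toLp] with x hx
      simp only [LinearMap.coe_mk, AddHom.coe_mk]
      rw [hx, norm_mul, Complex.norm_real]
      gcongr
      exact w.norm_coe_le_norm x

theorem coeFn_mulOp (w : BoundedContinuousFunction Plane ℝ) (f : Lp ℂ 2 μ) :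
    mulOp μ w f =ᵐ[μ] fun x => (w x : ℂ) * f x :=
  (memLp_bounded_mul w f).coeFn_toLp

theorem mulOp_mul (w v : BoundedContinuousFunction Plane ℝ) (f : Lp ℂ 2 μ) :
    mulOp μ (w * v) f = mulOp μ w (mulOp μ v f) := by
  refine Lp.ext ?_
  filter_upwards [coeFn_mulOp (w * v) f, coeFn_mulOp v f, coeFn_mulOp w (mulOp μ v f)]
    with x h1 h2 h3
  rw [h1, h3, h2]
  simp [mul_assoc]

theorem mulOp_comm (w v : BoundedContinuousFunction Plane ℝ) (f : Lp ℂ 2 μ) :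
    mulOp μ w (mulOp μ v f) = mulOp μ v (mulOp μ w f) := by
  rw [← mulOp_mul, ← mulOp_mul, mul_comm]

theorem inner_mulOp_left (w : BoundedContinuousFunction Plane ℝ) (f g : Lp ℂ 2 μ) :
    inner ℂ (mulOp μ w f) g = inner ℂ f (mulOp μ w g) := by
  rw [L2.inner_def, L2.inner_def]
  refine integral_congr_ae ?_
  filter_upwards [coeFn_mulOp w f, coeFn_mulOp w g] with x h1 h2
  rw [h1, h2]
  simp only [RCLike.inner_apply, map_mul, Complex.conj_ofReal]
  ring

theorem norm_sq_eq_integral (f : Lp ℂ 2 μ) : ‖f‖ ^ 2 = ∫ x, ‖f x‖ ^ 2 ∂μ := by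
  have h := congrArg Complex.re (L2.inner_def (𝕜 := ℂ) f f)
  rw [inner_self_eq_norm_sq_to_K] at h
  have h2 : ∀ x, inner ℂ (f x) (f x) = ((‖f x‖ ^ 2 : ℝ) : ℂ) := fun x => by
    rw [inner_self_eq_norm_sq_to_K]; simp
  simp_rw [h2] at h
  rw [integral_complex_ofReal, Complex.ofReal_re] at h
  simpa [← Complex.ofReal_pow] using h

theorem integrable_norm_sq (f : Lp ℂ 2 μ) : Integrable (fun x => ‖f x‖ ^ 2) μ :=
  (memLp_two_iff_integrable_sq_norm (Lp.memLp f).aestronglyMeasurable).1 (Lp.memLp f)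

theorem norm_sq_mulOp (w : BoundedContinuousFunction Plane ℝ) (f : Lp ℂ 2 μ) :
    ‖mulOp μ w f‖ ^ 2 = ∫ x, w x ^ 2 * ‖f x‖ ^ 2 ∂μ := by
  rw [norm_sq_eq_integral]
  refine integral_congr_ae ?_
  filter_upwards [coeFn_mulOp w f] with x h1
  rw [h1, norm_mul, mul_pow, Complex.norm_real, Real.norm_eq_abs, sq_abs]

theorem integrable_sq_mul_norm_sq (w : BoundedContinuousFunction Plane ℝ) (f : Lp ℂ 2 μ) :
    Integrable (fun x => w x ^ 2 * ‖f x‖ ^ 2) μ := by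
  refine (integrable_norm_sq (mulOp μ w f)).congr ?_
  filter_upwards [coeFn_mulOp w f] with x h1
  rw [h1, norm_mul, mul_pow, Complex.norm_real, Real.norm_eq_abs, sq_abs]

end Multiplication

/-! ### The form domain -/

/-- The Hilbert space of triples `(u, G, g)` of a function, a would-be magnetic gradient and a
would-be trace, normed by the sum of squares. -/
abbrev TripleSpace (Ω : Set Plane) : Type :=
  WithLp 2 (L2 Ω × WithLp 2 (PiLp 2 (fun _ : Fin 2 => L2 Ω) × L2Boundary Ω))

namespace TripleSpace

variable {Ω : Set Plane}

/-- The triple `(u, G, g)`. -/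
noncomputable def mk (u : L2 Ω) (G : Fin 2 → L2 Ω) (g : L2Boundary Ω) : TripleSpace Ω :=
  WithLp.toLp 2 (u, WithLp.toLp 2 (WithLp.toLp 2 G, g))

/-- The function of a triple. -/
noncomputable def fn (x : TripleSpace Ω) : L2 Ω := x.fst

/-- The `j`-th gradient component of a triple. -/
noncomputable def grad (x : TripleSpace Ω) (j : Fin 2) : L2 Ω := x.snd.fst j

/-- The boundary component of a triple. -/
noncomputable def bdry (x : TripleSpace Ω) : L2Boundary Ω := x.snd.snd

@[simp] theorem fn_mk (u : L2 Ω) (G : Fin 2 → L2 Ω) (g : L2Boundary Ω) : (mk u G g).fn = u := rfl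
@[simp] theorem grad_mk (u : L2 Ω) (G : Fin 2 → L2 Ω) (g : L2Boundary Ω) (j : Fin 2) :
    (mk u G g).grad j = G j := rfl
@[simp] theorem bdry_mk (u : L2 Ω) (G : Fin 2 → L2 Ω) (g : L2Boundary Ω) :
    (mk u G g).bdry = g := rfl

theorem norm_sq (x : TripleSpace Ω) :
    ‖x‖ ^ 2 = ‖x.fn‖ ^ 2 + (∑ j, ‖x.grad j‖ ^ 2 + ‖x.bdry‖ ^ 2) := by
  rw [WithLp.prod_norm_sq_eq_of_L2, WithLp.prod_norm_sq_eq_of_L2, PiLp.norm_sq_eq_of_L2]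
  rfl

@[fun_prop] theorem continuous_fn : Continuous (fn : TripleSpace Ω → L2 Ω) := by
  unfold fn; fun_prop

@[fun_prop] theorem continuous_grad (j : Fin 2) :
    Continuous (fun x : TripleSpace Ω => x.grad j) := by
  unfold grad; fun_prop

@[fun_prop] theorem continuous_bdry : Continuous (bdry : TripleSpace Ω → L2Boundary Ω) := by
  unfold bdry; fun_prop

theorem continuous_mk :
    Continuous (fun p : L2 Ω × (Fin 2 → L2 Ω) × L2Boundary Ω => mk p.1 p.2.1 p.2.2) := by
  unfold mk; fun_prop

end TripleSpace

open TripleSpace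

section FormDomain

variable {Ω : Set Plane} {h ζ : ℝ}

theorem continuous_A₀_apply (j : Fin 2) : Continuous fun x => A₀ x j := by
  fin_cases j <;> simp [A₀] <;> fun_prop

theorem continuous_partialDeriv {φ : Plane → ℂ} (hφ : ContDiff ℝ ∞ φ) (j : Fin 2) :
    Continuous (partialDeriv φ j) :=
  (hφ.continuous_fderiv (by simp)).clm_apply continuous_const

theorem hasCompactSupport_partialDeriv {φ : Plane → ℂ} (hφ : HasCompactSupport φ) (j : Fin 2) :
    HasCompactSupport (partialDeriv φ j) :=
  hφ.fderiv_apply ℝ _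

theorem continuous_magneticGrad {φ : Plane → ℂ} (hφ : ContDiff ℝ ∞ φ) (j : Fin 2) :
    Continuous (magneticGrad h ζ φ j) := by
  have h1 := continuous_partialDeriv hφ j
  have h2 := Complex.continuous_ofReal.comp (continuous_A₀_apply j)
  have h3 := hφ.continuous
  unfold magneticGrad
  exact (continuous_const.mul h1).sub ((continuous_const.mul h2).mul h3)

theorem hasCompactSupport_magneticGrad {φ : Plane → ℂ} (hφ : HasCompactSupport φ) (j : Fin 2) :
    HasCompactSupport (magneticGrad h ζ φ j) := by
  unfold magneticGrad
  have h1 := (hasCompactSupport_partialDeriv hφ j).mul_left (f := fun _ => (h : ℂ))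
  have h2 := hφ.mul_left (f := fun x => Complex.I * (ζ : ℂ) * ((A₀ x j : ℝ) : ℂ))
  exact h1.sub h2

theorem magneticGrad_add {φ ψ : Plane → ℂ} (hφ : ContDiff ℝ ∞ φ) (hψ : ContDiff ℝ ∞ ψ) (j : Fin 2)
    (x : Plane) :
    magneticGrad h ζ (φ + ψ) j x = magneticGrad h ζ φ j x + magneticGrad h ζ ψ j x := by
  unfold magneticGrad partialDeriv
  rw [fderiv_add (hφ.differentiable (by simp) x) (hψ.differentiable (by simp) x)]
  simp only [add_apply, Pi.add_apply]
  ring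

theorem magneticGrad_const_smul {φ : Plane → ℂ} (hφ : ContDiff ℝ ∞ φ) (c : ℂ) (j : Fin 2)
    (x : Plane) : magneticGrad h ζ (c • φ) j x = c * magneticGrad h ζ φ j x := by
  unfold magneticGrad partialDeriv
  rw [fderiv_const_smul (hφ.differentiable (by simp) x)]
  simp only [smul_apply, Pi.smul_apply, smul_eq_mul]
  ring

/-- The product rule `(h∇ - iζA₀)(wφ) = w (h∇ - iζA₀)φ + h (∇w) φ`. -/
theorem magneticGrad_mul {w : Plane → ℝ} (hw : ContDiff ℝ ∞ w) {φ : Plane → ℂ}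
    (hφ : ContDiff ℝ ∞ φ) (j : Fin 2) (x : Plane) :
    magneticGrad h ζ (fun y => (w y : ℂ) * φ y) j x =
      w x * magneticGrad h ζ φ j x
        + h * ((fderiv ℝ w x (EuclideanSpace.single j 1) : ℝ) * φ x) := by
  have h1 : HasFDerivAt (fun y => (w y : ℂ)) (Complex.ofRealCLM ∘L fderiv ℝ w x) x :=
    Complex.ofRealCLM.hasFDerivAt.comp x (hw.differentiable (by simp) x).hasFDerivAt
  have h2 := h1.mul (hφ.differentiable (by simp) x).hasFDerivAt
  unfold magneticGrad partialDeriv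
  rw [HasFDerivAt.fderiv (f := fun y => (w y : ℂ) * φ y) h2]
  simp
  ring

/-- The triples `(φ|_Ω, (h∇ - iζA₀)φ|_Ω, φ|_{∂Ω})` of the smooth compactly supported functions `φ`
on the plane. -/
noncomputable def smoothTriples (Ω : Set Plane) (h ζ : ℝ) : Submodule ℂ (TripleSpace Ω) where
  carrier := {x | ∃ φ : Plane → ℂ, ContDiff ℝ ∞ φ ∧ HasCompactSupport φ ∧
    x.fn =ᵐ[volume.restrict Ω] φ ∧
    (∀ j, x.grad j =ᵐ[volume.restrict Ω] magneticGrad h ζ φ j) ∧ x.bdry =ᵐ[arcLength Ω] φ}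
  zero_mem' := by
    refine ⟨0, contDiff_const, HasCompactSupport.zero, Lp.coeFn_zero _ _ _, fun j => ?_,
      Lp.coeFn_zero _ _ _⟩
    refine (Lp.coeFn_zero _ _ _).trans (Eventually.of_forall fun x => ?_)
    simp [magneticGrad, partialDeriv]
  add_mem' := by
    rintro x y ⟨φ, h1, h2, h3, h4, h5⟩ ⟨ψ, k1, k2, k3, k4, k5⟩
    refine ⟨φ + ψ, h1.add k1, h2.add k2, (Lp.coeFn_add _ _).trans (h3.add k3), fun j => ?_,
      (Lp.coeFn_add _ _).trans (h5.add k5)⟩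
    refine (Lp.coeFn_add _ _).trans (((h4 j).add (k4 j)).trans (Eventually.of_forall fun x => ?_))
    exact (magneticGrad_add h1 k1 j x).symm
  smul_mem' := by
    rintro c x ⟨φ, h1, h2, h3, h4, h5⟩
    refine ⟨c • φ, h1.const_smul c, h2.smul_left (f := fun _ => c),
      (Lp.coeFn_smul _ _).trans (h3.const_smul c), fun j => ?_,
      (Lp.coeFn_smul _ _).trans (h5.const_smul c)⟩
    refine (Lp.coeFn_smul _ _).trans (((h4 j).const_smul c).trans (Eventually.of_forall fun x => ?_))
    exact (magneticGrad_const_smul h1 c j x).symm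

/-- The form domain, as a closed space of triples `(u, G, g)`: `G` is the magnetic gradient and `g`
the trace of `u`. -/
noncomputable def formDomain (Ω : Set Plane) (h ζ : ℝ) : Submodule ℂ (TripleSpace Ω) :=
  (smoothTriples Ω h ζ).topologicalClosure

instance : CompleteSpace (formDomain Ω h ζ) :=
  (Submodule.isClosed_topologicalClosure _).completeSpace_coe

theorem formDomain_induction {p : TripleSpace Ω → Prop} (hp : IsClosed {x | p x})
    (hs : ∀ x ∈ smoothTriples Ω h ζ, p x) {x : TripleSpace Ω} (hx : x ∈ formDomain Ω h ζ) : p x :=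
  closure_minimal (fun y hy => hs y hy) hp hx

/-- The triple of a smooth compactly supported function. -/
noncomputable def smoothTriple (Ω : Set Plane) [IsFiniteMeasure (arcLength Ω)] (h ζ : ℝ)
    (φ : Plane → ℂ) (hφ : ContDiff ℝ ∞ φ) (hc : HasCompactSupport φ) : TripleSpace Ω :=
  mk ((hφ.continuous.memLp_of_hasCompactSupport hc).toLp φ)
    (fun j => ((continuous_magneticGrad hφ j).memLp_of_hasCompactSupport
      (hasCompactSupport_magneticGrad hc j)).toLp (magneticGrad h ζ φ j))
    ((hφ.continuous.memLp_of_hasCompactSupport hc).toLp φ)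

theorem smoothTriple_mem (Ω : Set Plane) [IsFiniteMeasure (arcLength Ω)] (h ζ : ℝ) (φ : Plane → ℂ)
    (hφ : ContDiff ℝ ∞ φ) (hc : HasCompactSupport φ) :
    smoothTriple Ω h ζ φ hφ hc ∈ smoothTriples Ω h ζ :=
  ⟨φ, hφ, hc, (hφ.continuous.memLp_of_hasCompactSupport hc).coeFn_toLp,
    fun j => ((continuous_magneticGrad hφ j).memLp_of_hasCompactSupport
      (hasCompactSupport_magneticGrad hc j)).coeFn_toLp,
    (hφ.continuous.memLp_of_hasCompactSupport hc).coeFn_toLp⟩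

theorem mk_mem_formDomain_iff [IsFiniteMeasure (arcLength Ω)] (u : L2 Ω) (G : Fin 2 → L2 Ω)
    (g : L2Boundary Ω) : mk u G g ∈ formDomain Ω h ζ ↔ IsTrace Ω h ζ u G g := by
  constructor
  · intro hx
    obtain ⟨y, hy, hlim⟩ := mem_closure_iff_seq_limit.1 (show mk u G g ∈ closure _ from hx)
    choose φ hφ using hy
    refine ⟨φ, fun n => ⟨(hφ n).1, (hφ n).2.1⟩, ?_, fun j => ?_, ?_⟩
    · have h1 := (Lp.tendsto_Lp_iff_tendsto_eLpNorm' _ _).1 ((continuous_fn.tendsto _).comp hlim)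
      refine h1.congr fun n => eLpNorm_congr_ae ?_
      filter_upwards [(hφ n).2.2.1] with x hx
      simp [hx]
    · have h1 := (Lp.tendsto_Lp_iff_tendsto_eLpNorm' _ _).1
        (((continuous_grad j).tendsto _).comp hlim)
      refine h1.congr fun n => eLpNorm_congr_ae ?_
      filter_upwards [(hφ n).2.2.2.1 j] with x hx
      simp [hx]
    · have h1 := (Lp.tendsto_Lp_iff_tendsto_eLpNorm' _ _).1 ((continuous_bdry.tendsto _).comp hlim)
      refine h1.congr fun n => eLpNorm_congr_ae ?_
      filter_upwards [(hφ n).2.2.2.2] with x hx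
      simp [hx]
  · rintro ⟨φ, hφ, h1, h2, h3⟩
    refine mem_closure_of_tendsto (f := fun n => smoothTriple Ω h ζ (φ n) (hφ n).1 (hφ n).2)
      (b := atTop) ?_ (Eventually.of_forall fun n => smoothTriple_mem Ω h ζ _ _ _)
    refine (continuous_mk.tendsto (u, G, g)).comp (f := fun n =>
      (((hφ n).1.continuous.memLp_of_hasCompactSupport (hφ n).2).toLp (φ n),
      (fun j => ((continuous_magneticGrad (hφ n).1 j).memLp_of_hasCompactSupport
        (hasCompactSupport_magneticGrad (hφ n).2 j)).toLp (magneticGrad h ζ (φ n) j)),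
      ((hφ n).1.continuous.memLp_of_hasCompactSupport (hφ n).2).toLp (φ n))) ?_
    refine Tendsto.prodMk_nhds ?_ (Tendsto.prodMk_nhds (tendsto_pi_nhds.2 fun j => ?_) ?_)
    · refine (Lp.tendsto_Lp_iff_tendsto_eLpNorm' _ _).2 (h1.congr fun n => eLpNorm_congr_ae ?_)
      filter_upwards [((hφ n).1.continuous.memLp_of_hasCompactSupport
        (μ := volume.restrict Ω) (p := 2) (hφ n).2).coeFn_toLp] with x hx
      simp [hx]
    · refine (Lp.tendsto_Lp_iff_tendsto_eLpNorm' _ _).2 ((h2 j).congr fun n => eLpNorm_congr_ae ?_)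
      filter_upwards [((continuous_magneticGrad (h := h) (ζ := ζ) (hφ n).1
        j).memLp_of_hasCompactSupport (μ := volume.restrict Ω) (p := 2)
        (hasCompactSupport_magneticGrad (hφ n).2 j)).coeFn_toLp] with x hx
      simp [hx]
    · refine (Lp.tendsto_Lp_iff_tendsto_eLpNorm' _ _).2 (h3.congr fun n => eLpNorm_congr_ae ?_)
      filter_upwards [((hφ n).1.continuous.memLp_of_hasCompactSupport
        (μ := arcLength Ω) (p := 2) (hφ n).2).coeFn_toLp] with x hx
      simp [hx]

theorem integral_mul_eq_inner {μ : Measure Plane} {φ : Plane → ℂ} (hφ : MemLp (star φ) 2 μ)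
    (f : Lp ℂ 2 μ) : ∫ x, f x * φ x ∂μ = inner ℂ (hφ.toLp _) f := by
  rw [L2.inner_def]
  refine integral_congr_ae ?_
  filter_upwards [hφ.coeFn_toLp] with x hx
  rw [hx]
  simp [RCLike.inner_apply]

/-- Integration by parts: the classical magnetic gradient of a smooth function is the distributional
one. -/
theorem setIntegral_magneticGrad_mul {φ ξ : Plane → ℂ} (hφ : ContDiff ℝ ∞ φ)
    (hc : HasCompactSupport φ) (hξ : ContDiff ℝ ∞ ξ) (hξc : HasCompactSupport ξ)
    (hξΩ : tsupport ξ ⊆ Ω) (j : Fin 2) :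
    ∫ x in Ω, magneticGrad h ζ φ j x * ξ x = - ∫ x in Ω, φ x *
      ((h : ℂ) * partialDeriv ξ j x + Complex.I * (ζ : ℂ) * ((A₀ x j : ℝ) : ℂ) * ξ x) := by
  have hz : ∀ x, x ∉ Ω → ξ x = 0 := fun x hx => image_eq_zero_of_notMem_tsupport fun h => hx (hξΩ h)
  have hz' : ∀ x, x ∉ Ω → partialDeriv ξ j x = 0 := fun x hx => by
    have : x ∉ tsupport (fderiv ℝ ξ) := fun h => hx (hξΩ (tsupport_fderiv_subset ℝ h))
    rw [partialDeriv, image_eq_zero_of_notMem_tsupport this]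
    rfl
  rw [setIntegral_eq_integral_of_forall_compl_eq_zero fun x hx => by rw [hz x hx, mul_zero],
    setIntegral_eq_integral_of_forall_compl_eq_zero fun x hx => by
      rw [hz x hx, hz' x hx, mul_zero, mul_zero, add_zero, mul_zero]]
  have hA : Continuous fun x => ((A₀ x j : ℝ) : ℂ) :=
    Complex.continuous_ofReal.comp (continuous_A₀_apply j)
  have i1 : Integrable (fun x => partialDeriv φ j x * ξ x) :=
    ((continuous_partialDeriv hφ j).mul hξ.continuous).integrable_of_hasCompactSupport
      hξc.mul_left
  have i2 : Integrable (fun x => φ x * partialDeriv ξ j x) :=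
    (hφ.continuous.mul (continuous_partialDeriv hξ j)).integrable_of_hasCompactSupport hc.mul_right
  have i3 : Integrable (fun x => φ x * ξ x) :=
    (hφ.continuous.mul hξ.continuous).integrable_of_hasCompactSupport hc.mul_right
  have i4 : Integrable (fun x => Complex.I * (ζ : ℂ) * ((A₀ x j : ℝ) : ℂ) * φ x * ξ x) :=
    (((continuous_const.mul hA).mul hφ.continuous).mul
      hξ.continuous).integrable_of_hasCompactSupport hξc.mul_left
  have key : ∫ x, φ x * partialDeriv ξ j x = - ∫ x, partialDeriv φ j x * ξ x :=
    integral_mul_fderiv_eq_neg_fderiv_mul_of_integrable i1 i2 i3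
      (fun x _ => hφ.differentiable (by simp) x) (fun x _ => hξ.differentiable (by simp) x)
  have e1 : ∀ x, magneticGrad h ζ φ j x * ξ x = (h : ℂ) * (partialDeriv φ j x * ξ x)
      - Complex.I * (ζ : ℂ) * ((A₀ x j : ℝ) : ℂ) * φ x * ξ x := fun x => by
    unfold magneticGrad; ring
  have e2 : ∀ x, φ x * ((h : ℂ) * partialDeriv ξ j x
      + Complex.I * (ζ : ℂ) * ((A₀ x j : ℝ) : ℂ) * ξ x) = (h : ℂ) * (φ x * partialDeriv ξ j x)
      + Complex.I * (ζ : ℂ) * ((A₀ x j : ℝ) : ℂ) * φ x * ξ x := fun x => by ring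
  simp_rw [e1, e2]
  rw [integral_sub (i1.const_mul _) i4, integral_add (i2.const_mul _) i4, integral_const_mul,
    integral_const_mul, key]
  ring

theorem isMagneticGrad_of_mem_formDomain {x : TripleSpace Ω}
    (hx : x ∈ formDomain Ω h ζ) : IsMagneticGrad Ω h ζ x.fn x.grad := by
  intro ξ hξ hξc hξΩ j
  have m1 : MemLp (star ξ) 2 (volume.restrict Ω) :=
    (hξ.continuous.memLp_of_hasCompactSupport hξc).star
  have hA : Continuous fun x => ((A₀ x j : ℝ) : ℂ) :=
    Complex.continuous_ofReal.comp (continuous_A₀_apply j)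
  have m2 : MemLp (star fun x => (h : ℂ) * partialDeriv ξ j x
      + Complex.I * (ζ : ℂ) * ((A₀ x j : ℝ) : ℂ) * ξ x) 2 (volume.restrict Ω) := by
    refine (Continuous.memLp_of_hasCompactSupport ?_ ?_).star
    · exact (continuous_const.mul (continuous_partialDeriv hξ j)).add
        ((continuous_const.mul hA).mul hξ.continuous)
    · exact HasCompactSupport.add (hasCompactSupport_partialDeriv hξc j).mul_left hξc.mul_left
  refine formDomain_induction (p := fun x => ∫ y in Ω, x.grad j y * ξ y = - ∫ y in Ω, x.fn y *
    ((h : ℂ) * partialDeriv ξ j y + Complex.I * (ζ : ℂ) * ((A₀ y j : ℝ) : ℂ) * ξ y)) ?_ ?_ hx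
  · simp_rw [fun f => integral_mul_eq_inner m1 f, fun f => integral_mul_eq_inner m2 f]
    exact isClosed_eq (Continuous.inner continuous_const (continuous_grad j))
      (Continuous.inner continuous_const continuous_fn).neg
  · rintro y ⟨φ, h1, h2, h3, h4, -⟩
    have := setIntegral_magneticGrad_mul (h := h) (ζ := ζ) h1 h2 hξ hξc hξΩ j
    rw [integral_congr_ae (g := fun x => magneticGrad h ζ φ j x * ξ x)
      (by filter_upwards [h4 j] with x hx; rw [hx]), this]
    congr 1
    refine integral_congr_ae ?_
    filter_upwards [h3] with x hx
    rw [hx]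

/-- Multiplication of a triple by a function `w` with partial derivatives `dw`, which transforms
gradients by the product rule. -/
noncomputable def mulTriple (h : ℝ) (w : BoundedContinuousFunction Plane ℝ)
    (dw : Fin 2 → BoundedContinuousFunction Plane ℝ) (x : TripleSpace Ω) : TripleSpace Ω :=
  mk (mulOp _ w x.fn) (fun j => mulOp _ w (x.grad j) + (h : ℂ) • mulOp _ (dw j) x.fn)
    (mulOp _ w x.bdry)

/-- The form domain is invariant under multiplication by smooth bounded functions with bounded
gradient. -/
theorem mulTriple_mem {w : BoundedContinuousFunction Plane ℝ}
    {dw : Fin 2 → BoundedContinuousFunction Plane ℝ} (hw : ContDiff ℝ ∞ w)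
    (hdw : ∀ j x, fderiv ℝ w x (EuclideanSpace.single j 1) = dw j x) {x : TripleSpace Ω}
    (hx : x ∈ formDomain Ω h ζ) : mulTriple h w dw x ∈ formDomain Ω h ζ := by
  have hcont : Continuous (mulTriple h w dw : TripleSpace Ω → TripleSpace Ω) := by
    refine continuous_mk.comp (f := fun x : TripleSpace Ω => (_, _, _)) ?_
    fun_prop
  refine map_mem_closure hcont hx ?_
  rintro y ⟨φ, h1, h2, h3, h4, h5⟩
  refine ⟨fun x => (w x : ℂ) * φ x, (Complex.ofRealCLM.contDiff.comp hw).mul h1, h2.mul_left,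
    ?_, fun j => ?_, ?_⟩
  · filter_upwards [h3, coeFn_mulOp w y.fn] with x e1 e2
    change mulOp _ w y.fn x = _
    rw [e2, e1]
  · filter_upwards [h3, h4 j, Lp.coeFn_add (mulOp _ w (y.grad j)) ((h : ℂ) • mulOp _ (dw j) y.fn),
      Lp.coeFn_smul (h : ℂ) (mulOp _ (dw j) y.fn), coeFn_mulOp w (y.grad j),
      coeFn_mulOp (dw j) y.fn] with x e1 e2 e3 e4 e5 e6
    change (mulOp _ w (y.grad j) + (h : ℂ) • mulOp _ (dw j) y.fn : L2 Ω) x = _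
    rw [e3, Pi.add_apply, e4, Pi.smul_apply, e5, e6, e1, e2, magneticGrad_mul hw h1, hdw]
    simp
  · filter_upwards [h5, coeFn_mulOp w y.bdry] with x e1 e2
    change mulOp _ w y.bdry x = _
    rw [e2, e1]

end FormDomain

/-! ### The Robin form and the Agmon identity -/

section RobinForm

variable {Ω : Set Plane} {h ζ : ℝ}

/-- A magnetic gradient is determined by the function. -/
theorem IsMagneticGrad.unique (hΩ : IsOpen Ω) {u : L2 Ω} {G G' : Fin 2 → L2 Ω}
    (hG : IsMagneticGrad Ω h ζ u G) (hG' : IsMagneticGrad Ω h ζ u G') : G = G' := by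
  funext j
  have hint : ∀ f : L2 Ω, LocallyIntegrable f (volume.restrict Ω) := fun f =>
    (Lp.memLp f).locallyIntegrable (by norm_num)
  have hsub : LocallyIntegrableOn (fun x => G j x - G' j x) Ω volume :=
    locallyIntegrableOn_of_locallyIntegrable_restrict ((hint _).sub (hint _))
  have key := hΩ.ae_eq_zero_of_integral_contDiff_smul_eq_zero hsub fun g hg hgc hgΩ => by
    have hφ : ContDiff ℝ ∞ fun x => (g x : ℂ) := Complex.ofRealCLM.contDiff.comp hg
    have hφc : HasCompactSupport fun x => (g x : ℂ) :=
      hgc.comp_left (g := ((↑) : ℝ → ℂ)) Complex.ofReal_zero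
    have hφΩ : tsupport (fun x => (g x : ℂ)) ⊆ Ω :=
      (tsupport_comp_subset Complex.ofReal_zero g).trans hgΩ
    have hz : ∀ x, x ∉ Ω → g x = 0 := fun x hx =>
      image_eq_zero_of_notMem_tsupport fun h => hx (hgΩ h)
    have hm : MemLp (star fun x => (g x : ℂ)) 2 (volume.restrict Ω) :=
      (hφ.continuous.memLp_of_hasCompactSupport hφc).star
    have e := (hG _ hφ hφc hφΩ j).trans (hG' _ hφ hφc hφΩ j).symm
    rw [integral_mul_eq_inner hm, integral_mul_eq_inner hm, ← sub_eq_zero, ← inner_sub_right,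
      ← integral_mul_eq_inner hm] at e
    rw [← setIntegral_eq_integral_of_forall_compl_eq_zero (s := Ω)
      fun x hx => by rw [hz x hx, zero_smul], ← e]
    refine integral_congr_ae ?_
    filter_upwards [Lp.coeFn_sub (G j) (G' j)] with x hx
    rw [hx, Complex.real_smul, Pi.sub_apply, mul_comm]
  refine Lp.ext ?_
  rw [EventuallyEq, ae_restrict_iff' hΩ.measurableSet]
  filter_upwards [key] with x hx hxΩ
  exact sub_eq_zero.1 (hx hxΩ)

/-- The function of a triple in the form domain, as a bounded operator. -/
noncomputable def fnL (Ω : Set Plane) (h ζ : ℝ) : formDomain Ω h ζ →L[ℂ] L2 Ω :=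
  (WithLp.fstL 2 ℂ _ _) ∘L (formDomain Ω h ζ).subtypeL

/-- The `j`-th gradient component of a triple in the form domain, as a bounded operator. -/
noncomputable def gradL (Ω : Set Plane) (h ζ : ℝ) (j : Fin 2) : formDomain Ω h ζ →L[ℂ] L2 Ω :=
  (PiLp.proj 2 (fun _ : Fin 2 => L2 Ω) j) ∘L (WithLp.fstL 2 ℂ _ _) ∘L (WithLp.sndL 2 ℂ _ _) ∘L
    (formDomain Ω h ζ).subtypeL

/-- The trace of a triple in the form domain, as a bounded operator. -/
noncomputable def bdryL (Ω : Set Plane) (h ζ : ℝ) : formDomain Ω h ζ →L[ℂ] L2Boundary Ω :=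
  (WithLp.sndL 2 ℂ _ _) ∘L (WithLp.sndL 2 ℂ _ _) ∘L (formDomain Ω h ζ).subtypeL

theorem fnL_apply (y : formDomain Ω h ζ) : fnL Ω h ζ y = y.1.fn := rfl

theorem gradL_apply (j : Fin 2) (y : formDomain Ω h ζ) : gradL Ω h ζ j y = y.1.grad j := rfl

theorem bdryL_apply (y : formDomain Ω h ζ) : bdryL Ω h ζ y = y.1.bdry := rfl

/-- The graph of the Robin Laplacian in terms of the Hilbert space `formDomain`: the trace condition
alone says that a triple belongs to it, and implies the condition on the gradient. -/
theorem robinLaplacian_eq [IsFiniteMeasure (arcLength Ω)] :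
    RobinLaplacian Ω h ζ = fun u f : L2 Ω => ∃ y, fnL Ω h ζ y = u ∧ ∀ z,
      ∑ j, inner ℂ (gradL Ω h ζ j z) (gradL Ω h ζ j y)
        - ((h ^ (3 / 2 : ℝ) : ℝ) : ℂ) * inner ℂ (bdryL Ω h ζ z) (bdryL Ω h ζ y)
        = inner ℂ (fnL Ω h ζ z) f := by
  funext u f
  simp only [fnL_apply, gradL_apply, bdryL_apply]
  refine propext ⟨?_, ?_⟩
  · rintro ⟨Gu, gu, hG, ht, hv⟩
    exact ⟨⟨mk u Gu gu, (mk_mem_formDomain_iff _ _ _).2 ht⟩, rfl, fun z =>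
      hv _ _ _ (isMagneticGrad_of_mem_formDomain z.2) ((mk_mem_formDomain_iff _ _ _).1 z.2)⟩
  · rintro ⟨y, rfl, hy⟩
    exact ⟨y.1.grad, y.1.bdry, isMagneticGrad_of_mem_formDomain y.2,
      (mk_mem_formDomain_iff _ _ _).1 y.2, fun v Gv gv hG ht =>
        hy ⟨mk v Gv gv, (mk_mem_formDomain_iff _ _ _).2 ht⟩⟩

theorem coercive_of_le {κ K a b d : ℝ} (ha : 0 ≤ a) (hb : 0 ≤ b) (hd : 0 ≤ d)
    (hle : κ * d ≤ 1 / 2 * b + K * a) :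
    min (1 / 4) (κ / 2) * (a + (b + d)) ≤ b - κ * d + (3 / 2 * K + 1) * a := by
  have m1 : min (1 / 4) (κ / 2) ≤ 1 / 4 := min_le_left _ _
  have m2 : min (1 / 4) (κ / 2) ≤ κ / 2 := min_le_right _ _
  nlinarith [mul_le_mul_of_nonneg_right m1 ha, mul_le_mul_of_nonneg_right m1 hb,
    mul_le_mul_of_nonneg_right m2 hd]

/-- The ground state energy is a lower bound of the quadratic form, as soon as the boundary term is
form bounded with relative bound `1/2`. -/
theorem IsGroundStateEnergy.le_form [IsFiniteMeasure (arcLength Ω)] (hh : 0 < h) {K lam : ℝ}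
    (htrace : ∀ x ∈ formDomain Ω h ζ, h ^ (3 / 2 : ℝ) * ‖x.bdry‖ ^ 2 ≤
      1 / 2 * ∑ j, ‖x.grad j‖ ^ 2 + K * ‖x.fn‖ ^ 2)
    (hlam : IsGroundStateEnergy Ω h ζ lam) {x : TripleSpace Ω} (hx : x ∈ formDomain Ω h ζ) :
    lam * ‖x.fn‖ ^ 2 ≤ ∑ j, ‖x.grad j‖ ^ 2 - h ^ (3 / 2 : ℝ) * ‖x.bdry‖ ^ 2 := by
  have hκ0 : 0 < h ^ (3 / 2 : ℝ) := Real.rpow_pos_of_pos hh _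
  have hc : 0 < min (1 / 4) (h ^ (3 / 2 : ℝ) / 2) := by positivity
  have hl := hlam.1
  rw [robinLaplacian_eq] at hl
  have hcoer : ∀ y : formDomain Ω h ζ, min (1 / 4) (h ^ (3 / 2 : ℝ) / 2) * ‖y‖ ^ 2 ≤
      ∑ j, ‖gradL Ω h ζ j y‖ ^ 2 - h ^ (3 / 2 : ℝ) * ‖bdryL Ω h ζ y‖ ^ 2
        + (3 / 2 * K + 1) * ‖fnL Ω h ζ y‖ ^ 2 := fun y => by
    refine (le_of_eq ?_).trans (coercive_of_le (sq_nonneg _)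
      (Finset.sum_nonneg fun _ _ => sq_nonneg _) (sq_nonneg _) (htrace y.1 y.2))
    rw [Submodule.coe_norm, TripleSpace.norm_sq]
    rfl
  have key := le_sum_sub_of_mem_lowerBounds_spectrum (H := L2 Ω) (V := formDomain Ω h ζ)
    (K := L2Boundary Ω) (fnL Ω h ζ) (gradL Ω h ζ) (bdryL Ω h ζ)
    (κ := h ^ (3 / 2 : ℝ)) (M := 3 / 2 * K + 1) hc
    (fun y => by with_reducible_and_instances exact hcoer y) (lam := lam)
  have key2 := key hl ⟨x, hx⟩
  simp_rw [fnL_apply, gradL_apply, bdryL_apply] at key2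
  exact key2

/-- The Agmon identity: testing the eigenvalue equation of `u` with `w² u` gives
`q(wu) = λ ‖wu‖² + h² ‖u ∇w‖²`. -/
theorem agmon_identity [IsFiniteMeasure (arcLength Ω)] {x : TripleSpace Ω}
    (hx : x ∈ formDomain Ω h ζ) {lam : ℝ}
    (heq : ∀ (v : L2 Ω) (Gv : Fin 2 → L2 Ω) (gv : L2Boundary Ω),
      IsMagneticGrad Ω h ζ v Gv → IsTrace Ω h ζ v Gv gv →
        robinForm h x.grad x.bdry Gv gv = inner ℂ v ((lam : ℂ) • x.fn))
    {w : BoundedContinuousFunction Plane ℝ} {dw : Fin 2 → BoundedContinuousFunction Plane ℝ}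
    (hw : ContDiff ℝ ∞ w) (hdw : ∀ j x, fderiv ℝ w x (EuclideanSpace.single j 1) = dw j x) :
    ∑ j, ‖(mulTriple h w dw x).grad j‖ ^ 2 - h ^ (3 / 2 : ℝ) * ‖mulOp _ w x.bdry‖ ^ 2 =
      lam * ‖mulOp _ w x.fn‖ ^ 2 + h ^ 2 * ∑ j, ‖mulOp _ (dw j) x.fn‖ ^ 2 := by
  have hm := mulTriple_mem hw hdw (mulTriple_mem hw hdw hx)
  have key := heq _ _ _ (isMagneticGrad_of_mem_formDomain hm) ((mk_mem_formDomain_iff _ _ _).1 hm)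
  have key2 := congrArg Complex.re key
  rw [robinForm, Complex.sub_re, Complex.re_ofReal_mul, Complex.re_sum, inner_smul_right,
    Complex.re_ofReal_mul] at key2
  simp only [mulTriple, fn_mk, bdry_mk, grad_mk] at key2 ⊢
  have hsq : ∀ {μ : Measure Plane} (f : Lp ℂ 2 μ),
      (inner ℂ (mulOp μ w (mulOp μ w f)) f).re = ‖mulOp μ w f‖ ^ 2 := fun f => by
    rw [inner_mulOp_left, inner_self_re_eq]
  rw [hsq, hsq] at key2
  have hj : ∀ j, ‖mulOp _ w (x.grad j) + (h : ℂ) • mulOp _ (dw j) x.fn‖ ^ 2 =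
      (inner ℂ (mulOp _ w (mulOp _ w (x.grad j) + (h : ℂ) • mulOp _ (dw j) x.fn)
        + (h : ℂ) • mulOp _ (dw j) (mulOp _ w x.fn)) (x.grad j)).re
      + h ^ 2 * ‖mulOp _ (dw j) x.fn‖ ^ 2 := by
    intro j
    rw [mulOp_comm (dw j) w, inner_add_left, inner_smul_left, inner_mulOp_left, inner_mulOp_left,
      inner_add_left, inner_smul_left, ← inner_self_re_eq, inner_add_left, inner_add_right, inner_add_right]
    simp only [inner_smul_left, inner_smul_right, Complex.add_re, Complex.conj_ofReal,
      Complex.re_ofReal_mul, inner_self_re_eq]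
    rw [← inner_conj_symm (mulOp _ w (x.grad j)), Complex.conj_re]
    ring
  simp_rw [hj, Finset.sum_add_distrib, ← Finset.mul_sum]
  linarith

end RobinForm

/-! ### Orthonormal frames of the plane -/

section Frame

/-- The unit vector `n` turned by a right angle. -/
def turn (n : Plane) : Plane := !₂[-n 1, n 0]

theorem inner_plane (x y : Plane) : inner ℝ x y = x 0 * y 0 + x 1 * y 1 := by
  rw [PiLp.inner_apply, Fin.sum_univ_two]
  simp [mul_comm]

theorem norm_sq_plane (x : Plane) : ‖x‖ ^ 2 = x 0 ^ 2 + x 1 ^ 2 := by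
  rw [← real_inner_self_eq_norm_sq, inner_plane]; ring

theorem sq_inner_turn_add_sq_inner {n : Plane} (hn : ‖n‖ = 1) (x : Plane) :
    inner ℝ (turn n) x ^ 2 + inner ℝ n x ^ 2 = ‖x‖ ^ 2 := by
  have h1 : n 0 ^ 2 + n 1 ^ 2 = 1 := by rw [← norm_sq_plane, hn]; norm_num
  rw [inner_plane, inner_plane, norm_sq_plane]
  simp only [turn, PiLp.toLp_apply, Matrix.cons_val_zero, Matrix.cons_val_one]
  linear_combination (x 0 ^ 2 + x 1 ^ 2) * h1

theorem norm_turn {n : Plane} (hn : ‖n‖ = 1) : ‖turn n‖ = 1 := by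
  have h1 : n 0 ^ 2 + n 1 ^ 2 = 1 := by rw [← norm_sq_plane, hn]; norm_num
  have : ‖turn n‖ ^ 2 = 1 := by
    rw [norm_sq_plane]; simp [turn]; linarith
  nlinarith [norm_nonneg (turn n)]

theorem inner_turn_self (n : Plane) : inner ℝ (turn n) n = 0 := by
  rw [inner_plane]; simp [turn]; ring

theorem orthonormal_frame {n : Plane} (hn : ‖n‖ = 1) : Orthonormal ℝ ![turn n, n] := by
  rw [orthonormal_iff_ite]
  intro i j
  have h2 := inner_turn_self n
  have h3 : inner ℝ n (turn n) = 0 := by rw [real_inner_comm]; exact h2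
  fin_cases i <;> fin_cases j <;>
    simp [norm_turn hn, hn, h2, h3]

/-- The point with coordinates `(s, t)` in the orthonormal frame `(turn n, n)` with origin `p`. -/
noncomputable def framePoint (p n : Plane) (st : ℝ × ℝ) : Plane :=
  p + (st.1 • turn n + st.2 • n)

theorem inner_turn_framePoint {p n : Plane} (hn : ‖n‖ = 1) (st : ℝ × ℝ) :
    inner ℝ (turn n) (framePoint p n st - p) = st.1 := by
  simp [framePoint, inner_add_right, inner_smul_right, inner_turn_self,
    norm_turn hn]

theorem inner_framePoint {p n : Plane} (hn : ‖n‖ = 1) (st : ℝ × ℝ) :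
    inner ℝ n (framePoint p n st - p) = st.2 := by
  have h3 : inner ℝ n (turn n) = 0 := by rw [real_inner_comm]; exact inner_turn_self n
  simp [framePoint, inner_add_right, inner_smul_right, h3, hn]

theorem framePoint_inner {p n : Plane} (hn : ‖n‖ = 1) (x : Plane) :
    framePoint p n (inner ℝ (turn n) (x - p), inner ℝ n (x - p)) = x := by
  have h := sq_inner_turn_add_sq_inner hn
    (framePoint p n (inner ℝ (turn n) (x - p), inner ℝ n (x - p)) - p - (x - p))
  rw [inner_sub_right _ (framePoint p n _ - p), inner_sub_right _ (framePoint p n _ - p),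
    inner_turn_framePoint hn, inner_framePoint hn] at h
  simp only [sub_self] at h
  have h2 : ‖framePoint p n (inner ℝ (turn n) (x - p), inner ℝ n (x - p)) - p - (x - p)‖ = 0 := by
    nlinarith
  rw [norm_eq_zero, sub_sub_sub_cancel_right, sub_eq_zero] at h2
  exact h2

theorem measurePreserving_framePoint (p : Plane) {n : Plane} (hn : ‖n‖ = 1) :
    MeasurePreserving (framePoint p n) (volume : Measure (ℝ × ℝ)) volume := by
  have hcard : Fintype.card (Fin 2) = Module.finrank ℝ Plane := by simp
  let b : OrthonormalBasis (Fin 2) ℝ Plane :=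
    OrthonormalBasis.mk (orthonormal_frame hn)
      (((orthonormal_frame hn).linearIndependent.span_eq_top_of_card_eq_finrank hcard).ge)
  have h1 := b.measurePreserving_repr_symm
  have h2 := PiLp.volume_preserving_toLp (Fin 2)
  have h3 := (volume_preserving_finTwoArrow ℝ).symm
  have h4 := measurePreserving_add_left (volume : Measure Plane) p
  have h5 := h4.comp (h1.comp (h2.comp h3))
  convert h5 using 1
  funext st
  simp [framePoint, b, MeasurableEquiv.finTwoArrow, ← OrthonormalBasis.sum_repr_symm]

end Frame

/-! ### Flat charts of the boundary -/

section Boundary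

variable {Ω : Set Plane}

/-- Near a boundary point `p` the domain is the sublevel set of a function `ψ` whose increments are
those of `x ↦ -⟪n, x⟫` up to a factor `η` of the distance. So `n` is the inward normal at `p`, and
`r` is the radius of the neighbourhood. Since `ψ` is normalized by its gradient at `p`, the factor `η`
can be chosen as small as desired, at the price of a small `r`. -/
structure IsFlatChart (Ω : Set Plane) (p n : Plane) (η r : ℝ) (ψ : Plane → ℝ) : Prop where
  r_pos : 0 < r
  sub : ∀ x ∈ Metric.ball p r, ∀ y ∈ Metric.ball p r,
    |ψ x - ψ y + inner ℝ n (x - y)| ≤ η * ‖x - y‖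
  zero : ψ p = 0
  mem_iff : ∀ x ∈ Metric.ball p r, x ∈ Ω ↔ ψ x < 0
  frontier_iff : ∀ x ∈ Metric.ball p r, x ∈ frontier Ω ↔ ψ x = 0

/-- Flat charts exist by the strict differentiability of a defining function. That its zeros are
exactly the boundary points, and not only contain them, uses that the gradient does not vanish. -/
theorem IsC3Domain.exists_flatChart (hΩ : IsC3Domain Ω) {p : Plane} (hp : p ∈ frontier Ω) :
    ∃ n : Plane, ‖n‖ = 1 ∧ ∀ η ∈ Set.Ioo (0 : ℝ) 1, ∃ r ψ, IsFlatChart Ω p n η r ψ := by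
  obtain ⟨U, ψ, hU, hpU, hψ, hd, hΩU⟩ := hΩ.smooth p hp
  have hstrict : HasStrictFDerivAt ψ (fderiv ℝ ψ p) p :=
    (hψ.contDiffAt (hU.mem_nhds hpU)).hasStrictFDerivAt (by norm_num)
  set L := fderiv ℝ ψ p with hL
  have hL0 : 0 < ‖L‖ := norm_pos_iff.2 hd
  set v : Plane := (InnerProductSpace.toDual ℝ Plane).symm L with hv
  have hvn : ‖v‖ = ‖L‖ := LinearIsometryEquiv.norm_map _ _
  have hvL : ∀ y, L y = inner ℝ v y := fun y => (InnerProductSpace.toDual_symm_apply).symm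
  refine ⟨-(‖L‖⁻¹ • v), ?_, fun η hη => ?_⟩
  · rw [norm_neg, norm_smul, hvn, norm_inv, norm_norm, inv_mul_cancel₀ hL0.ne']
  have h1 := hstrict.isLittleO.def (c := η * ‖L‖) (by have := hη.1; positivity)
  rw [nhds_prod_eq] at h1
  obtain ⟨t, ht, hsub⟩ := Filter.eventually_prod_self_iff'.1 h1
  obtain ⟨r, hr, hrU⟩ := Metric.mem_nhds_iff.1 (Filter.inter_mem ht (hU.mem_nhds hpU))
  have hmem : ∀ x ∈ Metric.ball p r, x ∈ Ω ↔ ψ x < 0 := fun x hx => by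
    have := Set.ext_iff.1 hΩU x
    simp only [Set.mem_inter_iff, Set.mem_ofPred_eq, (hrU hx).2, and_true, true_and] at this
    exact this
  have hcont : ContinuousOn ψ (Metric.ball p r) := hψ.continuousOn.mono fun x hx => (hrU hx).2
  have hsub' : ∀ x ∈ Metric.ball p r, ∀ y ∈ Metric.ball p r,
      |ψ x / ‖L‖ - ψ y / ‖L‖ + inner ℝ (-(‖L‖⁻¹ • v)) (x - y)| ≤ η * ‖x - y‖ := by
    intro x hx y hy
    have h2 := hsub x (hrU hx).1 y (hrU hy).1
    rw [hvL] at h2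
    have e : ψ x / ‖L‖ - ψ y / ‖L‖ + inner ℝ (-(‖L‖⁻¹ • v)) (x - y)
        = ‖L‖⁻¹ * (ψ x - ψ y - inner ℝ v (x - y)) := by
      rw [inner_neg_left, real_inner_smul_left]
      ring
    rw [e, abs_mul, abs_of_pos (inv_pos.2 hL0), inv_mul_le_iff₀ hL0]
    rw [Real.norm_eq_abs] at h2
    linarith
  have hzero : ∀ x ∈ Metric.ball p r, x ∈ frontier Ω → ψ x = 0 := by
    intro x hx hxf
    rw [frontier, hΩ.isOpen.interior_eq] at hxf
    have h2 : 0 ≤ ψ x := by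
      by_contra hlt
      exact hxf.2 ((hmem x hx).2 (not_le.1 hlt))
    refine le_antisymm ?_ h2
    by_contra hgt
    have h3 : ∀ᶠ y in 𝓝 x, 0 < ψ y :=
      (hcont.continuousAt (Metric.isOpen_ball.mem_nhds hx)).eventually (lt_mem_nhds (not_le.1 hgt))
    obtain ⟨y, hy, hyΩ⟩ := (mem_closure_iff_nhds.1 hxf.1) _
      (Filter.inter_mem h3 (Metric.isOpen_ball.mem_nhds hx))
    exact absurd ((hmem y hy.2).1 hyΩ) (not_lt.2 (le_of_lt hy.1))
  refine ⟨r, fun x => ψ x / ‖L‖, hr, hsub', ?_, fun x hx => ?_, fun x hx => ⟨fun hxf => ?_, ?_⟩⟩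
  · rw [hzero p (Metric.mem_ball_self hr) hp, zero_div]
  · rw [hmem x hx, div_lt_iff₀ hL0, zero_mul]
  · rw [hzero x hx hxf, zero_div]
  · intro hx0
    rw [frontier, hΩ.isOpen.interior_eq]
    constructor
    · -- the points `x + t n` with small `t > 0` lie in the domain
      have hlim : Tendsto (fun t : ℝ => x + t • (-(‖L‖⁻¹ • v))) (𝓝[>] 0) (𝓝 x) := by
        have : Continuous fun t : ℝ => x + t • (-(‖L‖⁻¹ • v)) := by fun_prop
        simpa using (this.tendsto 0).mono_left nhdsWithin_le_nhds
      refine mem_closure_of_tendsto hlim ?_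
      filter_upwards [hlim (Metric.isOpen_ball.mem_nhds hx), self_mem_nhdsWithin] with t ht htpos
      rw [hmem _ ht]
      have h4 := hsub' _ ht x hx
      have hn : ‖-(‖L‖⁻¹ • v)‖ = 1 := by
        rw [norm_neg, norm_smul, hvn, norm_inv, norm_norm, inv_mul_cancel₀ hL0.ne']
      rw [hx0, add_sub_cancel_left, inner_smul_right, real_inner_self_eq_norm_sq, norm_smul, hn] at h4
      have htpos' : (0 : ℝ) < t := htpos
      rw [Real.norm_eq_abs, abs_of_pos htpos'] at h4
      have h5 := (abs_le.1 h4).2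
      have h6 : ψ (x + t • (-(‖L‖⁻¹ • v))) / ‖L‖ < 0 := by nlinarith [hη.2]
      rwa [div_lt_iff₀ hL0, zero_mul] at h6
    · rw [hmem x hx]
      intro hlt
      rw [div_eq_zero_iff] at hx0
      rcases hx0 with h0 | h0 <;> linarith

namespace IsFlatChart

variable {p n : Plane} {η r : ℝ} {ψ : Plane → ℝ}

theorem abs_inner_le (hc : IsFlatChart Ω p n η r ψ) {x y : Plane} (hx : x ∈ Metric.ball p r)
    (hy : y ∈ Metric.ball p r) (hxf : x ∈ frontier Ω) (hyf : y ∈ frontier Ω) :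
    |inner ℝ n (x - y)| ≤ η * ‖x - y‖ := by
  have := hc.sub x hx y hy
  rwa [(hc.frontier_iff x hx).1 hxf, (hc.frontier_iff y hy).1 hyf, sub_zero, zero_add] at this

theorem add_smul_mem (hc : IsFlatChart Ω p n η r ψ) (hn : ‖n‖ = 1) (hη : η < 1) {x : Plane}
    (hx : x ∈ Metric.ball p r) (hxf : x ∈ frontier Ω) {t : ℝ} (ht : 0 < t)
    (hxt : x + t • n ∈ Metric.ball p r) : x + t • n ∈ Ω := by
  have h4 := hc.sub _ hxt x hx
  rw [(hc.frontier_iff x hx).1 hxf, add_sub_cancel_left, inner_smul_right,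
    real_inner_self_eq_norm_sq, norm_smul, hn, Real.norm_eq_abs, abs_of_pos ht] at h4
  have h5 := (abs_le.1 h4).2
  rw [hc.mem_iff _ hxt]
  nlinarith

theorem le_inner (hc : IsFlatChart Ω p n η r ψ) {x : Plane} (hx : x ∈ Metric.ball p r)
    (hxΩ : x ∈ Ω) : -(η * ‖x - p‖) ≤ inner ℝ n (x - p) := by
  have h4 := hc.sub _ hx p (Metric.mem_ball_self hc.r_pos)
  rw [hc.zero] at h4
  have h5 := (abs_le.1 h4).1
  have := (hc.mem_iff x hx).1 hxΩ
  linarith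

theorem continuousOn (hc : IsFlatChart Ω p n η r ψ) (hn : ‖n‖ = 1) (hη : η < 1) :
    ContinuousOn ψ (Metric.ball p r) := by
  have : LipschitzOnWith 2 ψ (Metric.ball p r) := by
    refine LipschitzOnWith.of_dist_le_mul fun x hx y hy => ?_
    have h1 := abs_le.1 (hc.sub x hx y hy)
    have h2 := abs_le.1 (abs_real_inner_le_norm n (x - y))
    rw [hn] at h2
    rw [Real.dist_eq, dist_eq_norm, abs_le]
    push_cast
    constructor <;> nlinarith [norm_nonneg (x - y)]
  exact this.continuousOn

/-- Every tangential coordinate `s` near `0` is attained on the boundary, at a height which is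
small compared with `s`. -/
theorem exists_frontier (hc : IsFlatChart Ω p n η r ψ) (hn : ‖n‖ = 1) (hη : η ∈ Set.Ioo 0 (1 / 2))
    {s : ℝ} (hs : |s| < r / 2) :
    ∃ t, |t| ≤ 2 * η * |s| ∧ framePoint p n (s, t) ∈ frontier Ω := by
  obtain ⟨h0, h1⟩ := hη
  have hnorm : ∀ t, ‖framePoint p n (s, t) - p‖ ≤ |s| + |t| := fun t => by
    rw [framePoint, add_sub_cancel_left]
    refine (norm_add_le _ _).trans ?_
    simp [norm_smul, hn, norm_turn hn]
  have hball : ∀ t ∈ Set.Icc (-(2 * η * |s|)) (2 * η * |s|),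
      framePoint p n (s, t) ∈ Metric.ball p r := fun t ht => by
    rw [mem_ball_iff_norm]
    have := abs_le.2 ht
    nlinarith [hnorm t, abs_nonneg s]
  have hψ : ∀ t ∈ Set.Icc (-(2 * η * |s|)) (2 * η * |s|),
      |ψ (framePoint p n (s, t)) + t| ≤ η * (|s| + |t|) := fun t ht => by
    have := hc.sub _ (hball t ht) p (Metric.mem_ball_self hc.r_pos)
    rw [hc.zero, sub_zero, inner_framePoint hn] at this
    exact this.trans (mul_le_mul_of_nonneg_left (hnorm t) h0.le)
  have hs0 : 0 ≤ 2 * η * |s| := by positivity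
  have hcont : ContinuousOn (fun t => ψ (framePoint p n (s, t)))
      (Set.Icc (-(2 * η * |s|)) (2 * η * |s|)) := by
    refine (hc.continuousOn hn (by linarith)).comp ?_ hball
    unfold framePoint
    fun_prop
  have ha := hψ _ (Set.left_mem_Icc.2 (by linarith))
  have hb := hψ _ (Set.right_mem_Icc.2 (by linarith))
  rw [abs_neg, abs_of_nonneg hs0] at ha
  rw [abs_of_nonneg hs0] at hb
  obtain ⟨t, ht, ht0⟩ := intermediate_value_Icc' (by linarith) hcont
    (show (0 : ℝ) ∈ Set.Icc _ _ from
      ⟨by nlinarith [(abs_le.1 hb).2, abs_nonneg s], by nlinarith [(abs_le.1 ha).1, abs_nonneg s]⟩)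
  exact ⟨t, abs_le.2 ht, (hc.frontier_iff _ (hball t ht)).2 ht0⟩

end IsFlatChart

end Boundary

/-! ### Arc length of the boundary -/

section Hausdorff

/-- The tangential coordinate, in the frame `(turn n, n)` with origin `p`. -/
noncomputable def tangential (p n : Plane) (x : Plane) : ℝ := inner ℝ (turn n) (x - p)

theorem continuous_tangential (p n : Plane) : Continuous (tangential p n) := by
  unfold tangential; fun_prop

theorem tangential_sub (p n x y : Plane) :
    tangential p n x - tangential p n y = inner ℝ (turn n) (x - y) := by
  rw [tangential, tangential, ← inner_sub_right, sub_sub_sub_cancel_right]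

theorem lipschitzWith_tangential (p : Plane) {n : Plane} (hn : ‖n‖ = 1) :
    LipschitzWith 1 (tangential p n) := by
  refine LipschitzWith.of_dist_le_mul fun x y => ?_
  rw [Real.dist_eq, tangential_sub, dist_eq_norm]
  simpa [norm_turn hn] using abs_real_inner_le_norm (turn n) (x - y)

/-- A set whose tangential projection covers `I` has at least the length of `I`, in integrated
form. -/
theorem setLIntegral_le_lintegral_tangential (p : Plane) {n : Plane} (hn : ‖n‖ = 1) {S : Set Plane}
    {I : Set ℝ} (hI : I ⊆ tangential p n '' S) {K : ℝ → ℝ≥0∞} (hK : Measurable K) :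
    ∫⁻ s in I, K s ≤ ∫⁻ x in S, K (tangential p n x) ∂μH[1] := by
  have hπ := (continuous_tangential p n).measurable
  rw [← lintegral_map (μ := (μH[1] : Measure Plane).restrict S) hK hπ]
  refine lintegral_mono' (Measure.le_iff.2 fun E hE => ?_) le_rfl
  rw [Measure.map_apply hπ hE, Measure.restrict_apply hE, Measure.restrict_apply (hπ hE)]
  have h1 : E ∩ I ⊆ tangential p n '' (tangential p n ⁻¹' E ∩ S) := by
    rintro s ⟨hsE, hsI⟩
    obtain ⟨x, hx, rfl⟩ := hI hsI
    exact ⟨x, ⟨hsE, hx⟩, rfl⟩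
  refine (measure_mono h1).trans ?_
  rw [← hausdorffMeasure_real]
  simpa using (lipschitzWith_tangential p hn).hausdorffMeasure_image_le zero_le_one
    (tangential p n ⁻¹' E ∩ S)

variable {Ω : Set Plane} {p n : Plane} {η r : ℝ} {ψ : Plane → ℝ}

namespace IsFlatChart

theorem norm_sub_le (hc : IsFlatChart Ω p n η r ψ) (hn : ‖n‖ = 1) (hη : η ∈ Set.Icc 0 (1 / 2))
    {x y : Plane} (hx : x ∈ frontier Ω ∩ Metric.ball p r) (hy : y ∈ frontier Ω ∩ Metric.ball p r) :
    ‖x - y‖ ≤ 2 * |tangential p n x - tangential p n y| := by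
  have h1 := hc.abs_inner_le hx.2 hy.2 hx.1 hy.1
  have h2 := sq_inner_turn_add_sq_inner hn (x - y)
  rw [← tangential_sub p] at h2
  have h3 : |inner ℝ n (x - y)| ≤ 1 / 2 * ‖x - y‖ :=
    h1.trans (mul_le_mul_of_nonneg_right hη.2 (norm_nonneg _))
  have h4 : inner ℝ n (x - y) ^ 2 ≤ (1 / 2 * ‖x - y‖) ^ 2 := by
    rw [← sq_abs]; gcongr
  refine abs_le_of_sq_le_sq' ?_ (by positivity) |>.2
  rw [mul_pow, sq_abs]
  nlinarith [sq_nonneg ‖x - y‖]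

/-- The boundary is, near `p`, a Lipschitz graph over its tangential projection. -/
theorem hausdorffMeasure_le (hc : IsFlatChart Ω p n η r ψ) (hn : ‖n‖ = 1)
    (hη : η ∈ Set.Icc 0 (1 / 2)) {S : Set Plane} (hS : S ⊆ frontier Ω ∩ Metric.ball p r) :
    μH[1] S ≤ 2 * volume (tangential p n '' S) := by
  have hinj : Set.InjOn (tangential p n) S := fun x hx y hy hxy => by
    have := hc.norm_sub_le hn hη (hS hx) (hS hy)
    rw [hxy, sub_self, abs_zero, mul_zero] at this
    exact sub_eq_zero.1 (norm_le_zero_iff.1 this)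
  have hinv := hinj.leftInvOn_invFunOn
  set g := Function.invFunOn (tangential p n) S
  have hg : LipschitzOnWith 2 g (tangential p n '' S) := by
    refine LipschitzOnWith.of_dist_le_mul ?_
    rintro _ ⟨x, hx, rfl⟩ _ ⟨y, hy, rfl⟩
    rw [hinv hx, hinv hy, dist_eq_norm, Real.dist_eq]
    exact hc.norm_sub_le hn hη (hS hx) (hS hy)
  have h1 := hg.hausdorffMeasure_image_le zero_le_one
  rw [hinv.image_image, hausdorffMeasure_real] at h1
  simpa using h1

theorem lintegral_tangential_le (hc : IsFlatChart Ω p n η r ψ) (hn : ‖n‖ = 1)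
    (hη : η ∈ Set.Icc 0 (1 / 2)) {S : Set Plane} (hS : S ⊆ frontier Ω ∩ Metric.ball p r)
    {K : ℝ → ℝ≥0∞} (hK : Measurable K) :
    ∫⁻ x in S, K (tangential p n x) ∂μH[1] ≤ 2 * ∫⁻ s, K s := by
  have hπ := (continuous_tangential p n).measurable
  rw [← lintegral_map (μ := (μH[1] : Measure Plane).restrict S) hK hπ, ← lintegral_const_mul _ hK,
    lintegral_const_mul _ hK, ← smul_eq_mul, ← lintegral_smul_measure]
  refine lintegral_mono' (Measure.le_iff.2 fun E hE => ?_) le_rfl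
  rw [Measure.map_apply hπ hE, Measure.restrict_apply (hπ hE)]
  refine (hc.hausdorffMeasure_le hn hη (Set.inter_subset_right.trans hS)).trans ?_
  rw [Measure.smul_apply, smul_eq_mul]
  gcongr
  rintro _ ⟨x, hx, rfl⟩
  exact hx.1

theorem hausdorffMeasure_lt_top (hc : IsFlatChart Ω p n η r ψ) (hn : ‖n‖ = 1)
    (hη : η ∈ Set.Icc 0 (1 / 2)) : μH[1] (frontier Ω ∩ Metric.ball p r) < ⊤ := by
  refine (hc.hausdorffMeasure_le hn hη subset_rfl).trans_lt (ENNReal.mul_lt_top (by simp) ?_)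
  refine (measure_mono ?_).trans_lt (measure_ball_lt_top (μ := volume) (x := (0 : ℝ)) (r := r))
  rintro _ ⟨x, hx, rfl⟩
  have h1 := (lipschitzWith_tangential p hn).dist_le_mul x p
  rw [Real.dist_eq] at h1
  simp only [tangential, sub_self, inner_zero_right, sub_zero, NNReal.coe_one, one_mul] at h1
  rw [mem_ball_zero_iff]
  exact h1.trans_lt hx.2

end IsFlatChart

theorem lintegral_eq_frame (p : Plane) {n : Plane} (hn : ‖n‖ = 1) {k : Plane → ℝ≥0∞}
    (hk : Measurable k) : ∫⁻ x, k x = ∫⁻ s, ∫⁻ t, k (framePoint p n (s, t)) := by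
  have h1 := measurePreserving_framePoint p hn
  rw [← h1.lintegral_comp hk, Measure.volume_eq_prod,
    lintegral_prod (fun z => k (framePoint p n z)) (hk.comp h1.measurable).aemeasurable]

theorem IsC3Domain.isFiniteMeasure_arcLength (hΩ : IsC3Domain Ω) :
    IsFiniteMeasure (arcLength Ω) := by
  refine ⟨?_⟩
  rw [arcLength, Measure.restrict_apply MeasurableSet.univ, Set.univ_inter]
  refine hΩ.isCompact_frontier.measure_lt_top_of_nhdsWithin fun p hp => ?_
  obtain ⟨n, hn, hchart⟩ := hΩ.exists_flatChart hp
  obtain ⟨r, ψ, hc⟩ := hchart (1 / 2) (by norm_num)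
  exact ⟨_, inter_mem_nhdsWithin _ (Metric.ball_mem_nhds p hc.r_pos),
    hc.hausdorffMeasure_lt_top hn (by norm_num)⟩

end Hausdorff

/-! ### The trace inequality and the form bound -/

section Trace

variable {Ω : Set Plane} {p n : Plane} {η r : ℝ} {ψ : Plane → ℝ}

/-- The fundamental theorem of calculus along `n`, with the linear cutoff `1 - t / ρ`. -/
theorem le_integral_of_deriv_le {f k : Plane → ℝ} (hf : ContDiff ℝ 1 f) (hk : Continuous k)
    {ρ : ℝ} (hρ : 0 < ρ) (hfk : ∀ x, |fderiv ℝ f x n| + ρ⁻¹ * |f x| ≤ k x) (x : Plane) :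
    f x ≤ ∫ t in (0 : ℝ)..ρ, k (x + t • n) := by
  have hline : ∀ t : ℝ, HasDerivAt (fun t : ℝ => x + t • n) n t := fun t => by
    simpa using ((hasDerivAt_id t).smul_const n).const_add x
  have hd : ∀ t : ℝ, HasDerivAt (fun t : ℝ => (1 - ρ⁻¹ * t) * f (x + t • n))
      (-ρ⁻¹ * f (x + t • n) + (1 - ρ⁻¹ * t) * fderiv ℝ f (x + t • n) n) t := fun t => by
    have h1 := (hf.differentiable one_ne_zero (x + t • n)).hasFDerivAt.comp_hasDerivAt t (hline t)
    have h2 : HasDerivAt (fun t : ℝ => 1 - ρ⁻¹ * t) (-ρ⁻¹) t := by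
      simpa using ((hasDerivAt_id t).const_mul ρ⁻¹).const_sub 1
    exact h2.mul h1
  have hcd : Continuous fun t : ℝ =>
      -ρ⁻¹ * f (x + t • n) + (1 - ρ⁻¹ * t) * fderiv ℝ f (x + t • n) n := by
    have h1 := hf.continuous
    have h2 := hf.continuous_fderiv one_ne_zero
    fun_prop
  have key := intervalIntegral.integral_eq_sub_of_hasDerivAt (a := 0) (b := ρ) (fun t _ => hd t)
    (hcd.intervalIntegrable _ _)
  simp only [inv_mul_cancel₀ hρ.ne', sub_self, zero_mul, mul_zero, sub_zero, one_mul, zero_smul,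
    add_zero, zero_sub] at key
  have h3 : f x = ∫ t in (0 : ℝ)..ρ,
      -(-ρ⁻¹ * f (x + t • n) + (1 - ρ⁻¹ * t) * fderiv ℝ f (x + t • n) n) := by
    rw [intervalIntegral.integral_neg, key, neg_neg]
  rw [h3]
  refine intervalIntegral.integral_mono_on hρ.le (hcd.neg.intervalIntegrable _ _)
    (Continuous.intervalIntegrable (by fun_prop) _ _) fun t ht => ?_
  refine le_trans ?_ (hfk (x + t • n))
  have h4 : 0 ≤ 1 - ρ⁻¹ * t := by
    rw [sub_nonneg, inv_mul_le_iff₀ hρ]; linarith [ht.2]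
  have h5 : 1 - ρ⁻¹ * t ≤ 1 := by
    have := mul_nonneg (inv_pos.2 hρ).le ht.1; linarith
  have h6 := mul_le_mul_of_nonneg_left (neg_abs_le (fderiv ℝ f (x + t • n) n)) h4
  have h7 := mul_le_mul_of_nonneg_right h5 (abs_nonneg (fderiv ℝ f (x + t • n) n))
  have h8 := mul_le_mul_of_nonneg_left (le_abs_self (f (x + t • n))) (inv_pos.2 hρ).le
  linarith

/-- The local trace inequality: every boundary point is joined to the interior by a segment in
direction `n`, and the segments sweep out a part of the domain. -/
theorem IsFlatChart.lintegral_frontier_le (hΩ : IsOpen Ω) (hc : IsFlatChart Ω p n η r ψ)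
    (hn : ‖n‖ = 1) (hη : η ∈ Set.Icc 0 (1 / 2)) {f k : Plane → ℝ} (hf : ContDiff ℝ 1 f)
    (hk : Continuous k) (hfk : ∀ x, |fderiv ℝ f x n| + (r / 2)⁻¹ * |f x| ≤ k x) :
    ∫⁻ x in frontier Ω ∩ Metric.ball p (r / 2), ENNReal.ofReal (f x) ∂μH[1] ≤
      2 * ∫⁻ x in Ω, ENNReal.ofReal (k x) := by
  have hr := hc.r_pos
  set k₁ : Plane → ℝ≥0∞ := Ω.indicator fun x => ENNReal.ofReal (k x) with hk₁
  have hk₁m : Measurable k₁ :=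
    (ENNReal.measurable_ofReal.comp hk.measurable).indicator hΩ.measurableSet
  have hk0 : ∀ x, 0 ≤ k x := fun x => le_trans (by positivity) (hfk x)
  set K : ℝ → ℝ≥0∞ := fun s => ∫⁻ t, k₁ (framePoint p n (s, t)) with hK
  have hKm : Measurable K :=
    (hk₁m.comp (measurePreserving_framePoint p hn).measurable).lintegral_prod_right'
  have hpt : ∀ x ∈ frontier Ω ∩ Metric.ball p (r / 2),
      ENNReal.ofReal (f x) ≤ K (tangential p n x) := by
    rintro x ⟨hxf, hxb⟩
    have hxr : x ∈ Metric.ball p r := Metric.ball_subset_ball (by linarith) hxb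
    have h1 := le_integral_of_deriv_le hf hk (by positivity : 0 < r / 2) hfk x
    have hcont : Continuous fun t : ℝ => k (x + t • n) := by fun_prop
    calc ENNReal.ofReal (f x) ≤ ENNReal.ofReal (∫ t in (0 : ℝ)..(r / 2), k (x + t • n)) :=
          ENNReal.ofReal_le_ofReal h1
      _ = ∫⁻ t in Set.Ioo 0 (r / 2), ENNReal.ofReal (k (x + t • n)) := by
          rw [intervalIntegral.integral_of_le (by positivity), integral_Ioc_eq_integral_Ioo,
            ofReal_integral_eq_lintegral_ofReal]
          · exact (hcont.continuousOn.integrableOn_Icc (a := 0) (b := r / 2)).mono_set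
              Set.Ioo_subset_Icc_self
          · exact Eventually.of_forall fun t => hk0 _
      _ ≤ ∫⁻ t in Set.Ioo 0 (r / 2), k₁ (x + t • n) := by
          refine setLIntegral_mono' measurableSet_Ioo fun t ht => ?_
          have hmem : x + t • n ∈ Ω := by
            refine hc.add_smul_mem hn (by linarith [hη.2]) hxr hxf ht.1 ?_
            rw [mem_ball_iff_norm] at hxb ⊢
            rw [add_sub_right_comm]
            refine (norm_add_le _ _).trans_lt ?_
            rw [norm_smul, hn, Real.norm_eq_abs, abs_of_pos ht.1]
            linarith [ht.2]
          rw [hk₁, Set.indicator_of_mem hmem]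
      _ ≤ ∫⁻ t, k₁ (x + t • n) := setLIntegral_le_lintegral _ _
      _ = K (tangential p n x) := by
          simp only [hK]
          refine Eq.trans (lintegral_congr fun t => congrArg k₁ ?_) (lintegral_add_left_eq_self
            (fun τ => k₁ (framePoint p n (tangential p n x, τ))) (inner ℝ n (x - p)))
          conv_lhs => rw [← framePoint_inner (p := p) hn x]
          simp only [framePoint, tangential]
          module
  have hmeas : MeasurableSet (frontier Ω ∩ Metric.ball p (r / 2)) :=
    isClosed_frontier.measurableSet.inter measurableSet_ball
  calc _ ≤ ∫⁻ x in frontier Ω ∩ Metric.ball p (r / 2), K (tangential p n x) ∂μH[1] :=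
        setLIntegral_mono' hmeas hpt
    _ ≤ 2 * ∫⁻ s, K s := hc.lintegral_tangential_le hn hη
        (Set.inter_subset_inter_right _ (Metric.ball_subset_ball (by linarith))) hKm
    _ = 2 * ∫⁻ x, k₁ x := by rw [lintegral_eq_frame p hn hk₁m]
    _ = _ := by rw [hk₁, lintegral_indicator hΩ.measurableSet]

/-- The trace inequality in `L¹`, for a domain with compact boundary. -/
theorem IsC3Domain.exists_trace_const (hΩ : IsC3Domain Ω) :
    ∃ C : ℝ, 0 ≤ C ∧ ∀ f k : Plane → ℝ, ContDiff ℝ 1 f → Continuous k →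
      (∀ x n, ‖n‖ = 1 → |fderiv ℝ f x n| + |f x| ≤ k x) →
      ∫⁻ x, ENNReal.ofReal (f x) ∂arcLength Ω ≤
        ENNReal.ofReal C * ∫⁻ x in Ω, ENNReal.ofReal (k x) := by
  have key := hΩ.isCompact_frontier.induction_on (p := fun S => ∃ C : ℝ, 0 ≤ C ∧
    ∀ f k : Plane → ℝ, ContDiff ℝ 1 f → Continuous k →
      (∀ x n, ‖n‖ = 1 → |fderiv ℝ f x n| + |f x| ≤ k x) →
      ∫⁻ x in S, ENNReal.ofReal (f x) ∂μH[1] ≤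
        ENNReal.ofReal C * ∫⁻ x in Ω, ENNReal.ofReal (k x)) ?_ ?_ ?_ ?_
  · exact key
  · exact ⟨0, le_rfl, by simp⟩
  · rintro S T hST ⟨C, hC, h⟩
    exact ⟨C, hC, fun f k h1 h2 h3 => (lintegral_mono_set hST).trans (h f k h1 h2 h3)⟩
  · rintro S T ⟨C, hC, h⟩ ⟨D, hD, h'⟩
    refine ⟨C + D, add_nonneg hC hD, fun f k h1 h2 h3 => ?_⟩
    rw [ENNReal.ofReal_add hC hD, add_mul]
    exact (lintegral_union_le _ _ _).trans (add_le_add (h f k h1 h2 h3) (h' f k h1 h2 h3))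
  · intro p hp
    obtain ⟨n, hn, hchart⟩ := hΩ.exists_flatChart hp
    obtain ⟨r, ψ, hc⟩ := hchart (1 / 2) (by norm_num)
    have hr := hc.r_pos
    refine ⟨_, inter_mem_nhdsWithin _ (Metric.ball_mem_nhds p (by positivity : 0 < r / 2)),
      2 * max 1 (r / 2)⁻¹, by positivity, fun f k h1 h2 h3 => ?_⟩
    have hm : (0 : ℝ) ≤ max 1 (r / 2)⁻¹ := by positivity
    refine (hc.lintegral_frontier_le hΩ.isOpen hn (by norm_num) (k := fun x =>
      max 1 (r / 2)⁻¹ * k x) h1 (by fun_prop) fun x => ?_).trans (le_of_eq ?_)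
    · refine le_trans ?_ (mul_le_mul_of_nonneg_left (h3 x n hn) hm)
      rw [mul_add]
      have e1 := mul_le_mul_of_nonneg_right (le_max_left 1 (r / 2)⁻¹) (abs_nonneg (fderiv ℝ f x n))
      have e2 := mul_le_mul_of_nonneg_right (le_max_right 1 (r / 2)⁻¹) (abs_nonneg (f x))
      linarith
    · simp_rw [ENNReal.ofReal_mul hm]
      rw [lintegral_const_mul' _ _ ENNReal.ofReal_ne_top, ENNReal.ofReal_mul zero_le_two, mul_assoc]
      simp

theorem ofReal_norm_sq {μ : Measure Plane} (f : Lp ℂ 2 μ) :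
    ENNReal.ofReal (‖f‖ ^ 2) = ∫⁻ x, ENNReal.ofReal (‖f x‖ ^ 2) ∂μ := by
  rw [norm_sq_eq_integral, ofReal_integral_eq_lintegral_ofReal (integrable_norm_sq f)]
  exact Eventually.of_forall fun x => sq_nonneg _

/-- The diamagnetic bound of the derivatives of `|φ|²`. -/
theorem abs_fderiv_norm_sq_le {h ζ : ℝ} (hh : 0 < h) {φ : Plane → ℂ} (hφ : ContDiff ℝ ∞ φ)
    (x : Plane) {n : Plane} (hn : ‖n‖ = 1) :
    |fderiv ℝ (fun y => ‖φ y‖ ^ 2) x n| ≤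
      2 * h⁻¹ * (‖φ x‖ * ∑ j, ‖magneticGrad h ζ φ j x‖) := by
  have hd := (hφ.differentiable (by simp) x).hasFDerivAt.norm_sq
  have hnj : n = n 0 • EuclideanSpace.single 0 1 + n 1 • EuclideanSpace.single 1 1 := by
    ext j; fin_cases j <;> simp
  have hj : ∀ j, h * inner ℝ (φ x) (partialDeriv φ j x) =
      inner ℝ (φ x) (magneticGrad h ζ φ j x) := fun j => by
    simp only [magneticGrad, Complex.inner]
    simp
    ring
  have hDn : fderiv ℝ φ x n = n 0 • partialDeriv φ 0 x + n 1 • partialDeriv φ 1 x := by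
    conv_lhs => rw [hnj, map_add, map_smul, map_smul]
    rfl
  have e : fderiv ℝ (fun y => ‖φ y‖ ^ 2) x n = 2 * h⁻¹ *
      (n 0 * inner ℝ (φ x) (magneticGrad h ζ φ 0 x)
        + n 1 * inner ℝ (φ x) (magneticGrad h ζ φ 1 x)) := by
    rw [hd.fderiv, ← hj, ← hj]
    simp only [smul_apply, ContinuousLinearMap.comp_apply, innerSL_apply_apply, hDn,
      inner_add_right, real_inner_smul_right]
    simp
    field_simp
  rw [e, abs_mul, abs_of_pos (by positivity : 0 < 2 * h⁻¹)]
  refine mul_le_mul_of_nonneg_left ?_ (by positivity)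
  have hcomp : ∀ j, |n j| ≤ 1 := fun j => hn ▸ (PiLp.norm_apply_le n j)
  have hin : ∀ j, |n j * inner ℝ (φ x) (magneticGrad h ζ φ j x)| ≤
      ‖φ x‖ * ‖magneticGrad h ζ φ j x‖ := fun j => by
    rw [abs_mul]
    exact (mul_le_of_le_one_left (abs_nonneg _) (hcomp j)).trans (abs_real_inner_le_norm _ _)
  rw [Fin.sum_univ_two, mul_add]
  exact (abs_add_le _ _).trans (add_le_add (hin 0) (hin 1))

/-- The boundary term of the Robin form is form bounded, uniformly in the magnetic field, with a
remainder of order `h`. -/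
theorem IsC3Domain.exists_form_bound (hΩ : IsC3Domain Ω) :
    ∃ C : ℝ, 0 ≤ C ∧ ∀ h ∈ Set.Ioo (0 : ℝ) 1, ∀ ζ : ℝ, ∀ x ∈ formDomain Ω h ζ,
      h ^ (3 / 2 : ℝ) * ‖x.bdry‖ ^ 2 ≤ 1 / 2 * ∑ j, ‖x.grad j‖ ^ 2 + C * h * ‖x.fn‖ ^ 2 := by
  obtain ⟨C, hC, htr⟩ := hΩ.exists_trace_const
  refine ⟨4 * C ^ 2 + C, by positivity, fun h ⟨hh, hh1⟩ ζ x hx => ?_⟩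
  refine formDomain_induction (p := fun x => h ^ (3 / 2 : ℝ) * ‖x.bdry‖ ^ 2 ≤
    1 / 2 * ∑ j, ‖x.grad j‖ ^ 2 + (4 * C ^ 2 + C) * h * ‖x.fn‖ ^ 2) ?_ ?_ hx
  · exact isClosed_le (by fun_prop) (by fun_prop)
  rintro y ⟨φ, h1, h2, h3, h4, h5⟩
  have hκ : h ^ (3 / 2 : ℝ) = h * Real.sqrt h := by
    rw [show (3 / 2 : ℝ) = 1 + 1 / 2 by norm_num, Real.rpow_add hh, Real.rpow_one,
      Real.sqrt_eq_rpow]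
  have hs0 : 0 ≤ Real.sqrt h := Real.sqrt_nonneg h
  have hs2 : Real.sqrt h ^ 2 = h := Real.sq_sqrt hh.le
  have hs1 : Real.sqrt h ≤ 1 := by nlinarith
  set k : Plane → ℝ := fun x =>
    2 * h⁻¹ * (‖φ x‖ * ∑ j, ‖magneticGrad h ζ φ j x‖) + ‖φ x‖ ^ 2 with hk
  have hφc := h1.continuous
  have hkc : Continuous k := by
    have := fun j => continuous_magneticGrad (h := h) (ζ := ζ) h1 j
    fun_prop
  have key := htr (fun x => ‖φ x‖ ^ 2) k ((h1.norm_sq ℝ).of_le (by simp)) hkc fun x n hn => by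
    rw [abs_of_nonneg (sq_nonneg ‖φ x‖)]
    exact add_le_add (abs_fderiv_norm_sq_le hh h1 x hn) le_rfl
  have hR : 0 ≤ 1 / 2 * ∑ j, ‖y.grad j‖ ^ 2 + (4 * C ^ 2 + C) * h * ‖y.fn‖ ^ 2 := by positivity
  rw [← ENNReal.ofReal_le_ofReal_iff hR]
  have hint : Integrable (fun x => 1 / 2 * ∑ j, ‖y.grad j x‖ ^ 2
      + (4 * C ^ 2 + C) * h * ‖y.fn x‖ ^ 2) (volume.restrict Ω) :=
    ((integrable_finsetSum _ fun j _ => integrable_norm_sq _).const_mul _).add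
      ((integrable_norm_sq _).const_mul _)
  have hRe : 1 / 2 * ∑ j, ‖y.grad j‖ ^ 2 + (4 * C ^ 2 + C) * h * ‖y.fn‖ ^ 2 =
      ∫ x in Ω, 1 / 2 * ∑ j, ‖y.grad j x‖ ^ 2 + (4 * C ^ 2 + C) * h * ‖y.fn x‖ ^ 2 := by
    rw [integral_add ((integrable_finsetSum _ fun j _ => integrable_norm_sq _).const_mul _)
      ((integrable_norm_sq _).const_mul _), integral_const_mul, integral_const_mul,
      integral_finsetSum _ fun j _ => integrable_norm_sq _, norm_sq_eq_integral y.fn]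
    simp_rw [norm_sq_eq_integral]
  rw [ENNReal.ofReal_mul (by positivity), ofReal_norm_sq,
    lintegral_congr_ae (g := fun x => ENNReal.ofReal (‖φ x‖ ^ 2))
      (by filter_upwards [h5] with x hx; rw [hx]), hRe,
    ofReal_integral_eq_lintegral_ofReal hint (Eventually.of_forall fun x => by positivity)]
  calc _ ≤ ENNReal.ofReal (h ^ (3 / 2 : ℝ)) *
        (ENNReal.ofReal C * ∫⁻ x in Ω, ENNReal.ofReal (k x)) := by gcongr
    _ = ∫⁻ x in Ω, ENNReal.ofReal (h ^ (3 / 2 : ℝ) * C * k x) := by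
        rw [← mul_assoc, ← ENNReal.ofReal_mul (by positivity),
          ← lintegral_const_mul' _ _ ENNReal.ofReal_ne_top]
        simp_rw [← ENNReal.ofReal_mul (show 0 ≤ h ^ (3 / 2 : ℝ) * C by positivity)]
    _ ≤ _ := by
        refine lintegral_mono_ae ?_
        filter_upwards [h3, h4 0, h4 1] with x e3 e4 e5
        refine ENNReal.ofReal_le_ofReal ?_
        simp only [hk, hκ, Fin.sum_univ_two, e3, e4, e5]
        generalize ‖magneticGrad h ζ φ 0 x‖ = a
        generalize ‖magneticGrad h ζ φ 1 x‖ = b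
        generalize ‖φ x‖ = c
        have e : h * Real.sqrt h * C * (2 * h⁻¹ * (c * (a + b)) + c ^ 2) =
            2 * (C * Real.sqrt h * c) * a + 2 * (C * Real.sqrt h * c) * b
              + Real.sqrt h * (C * h * c ^ 2) := by
          field_simp
        rw [e]
        have e6 : (C * Real.sqrt h * c) ^ 2 = C ^ 2 * h * c ^ 2 := by
          rw [mul_pow, mul_pow, hs2]
        have e7 : Real.sqrt h * (C * h * c ^ 2) ≤ C * h * c ^ 2 :=
          mul_le_of_le_one_left (by positivity) hs1
        nlinarith [sq_nonneg (a - 2 * (C * Real.sqrt h * c)),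
          sq_nonneg (b - 2 * (C * Real.sqrt h * c))]

end Trace

/-! ### Profiles of the trial function -/

section Profile

theorem exists_forall_abs_ge_eq_zero {a : ℝ → ℝ} (ha : HasCompactSupport a) :
    ∃ R : ℝ, 0 < R ∧ ∀ s, R ≤ |s| → a s = 0 ∧ deriv a s = 0 := by
  obtain ⟨R, hR0, hR⟩ := ha.isCompact.isBounded.exists_pos_norm_lt
  refine ⟨R, hR0, fun s hs => ⟨image_eq_zero_of_notMem_tsupport fun h => ?_, ?_⟩⟩
  · exact absurd (hR s h) (not_lt.2 hs)
  · by_contra h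
    exact absurd (hR s (support_deriv_subset h)) (not_lt.2 hs)

/-- A tangential profile with small Dirichlet energy. -/
theorem exists_tangential_profile {δ : ℝ} (hδ : 0 < δ) :
    ∃ a : ℝ → ℝ, ContDiff ℝ ∞ a ∧ HasCompactSupport a ∧ 0 < ∫ s, a s ^ 2 ∧
      ∫ s, deriv a s ^ 2 ≤ δ * ∫ s, a s ^ 2 := by
  let χ : ContDiffBump (0 : ℝ) := ⟨1, 2, one_pos, one_lt_two⟩
  have hχ : ContDiff ℝ ∞ χ := χ.contDiff
  set A := ∫ s, χ s ^ 2 with hA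
  set B := ∫ s, deriv χ s ^ 2 with hB
  have hA0 : 0 < A := by
    refine (hχ.continuous.pow 2).integral_pos_of_hasCompactSupport_nonneg_nonzero (x := 0)
      (χ.hasCompactSupport.comp_left (g := fun y : ℝ => y ^ 2) (by simp))
      (fun x => sq_nonneg _) ?_
    have : χ 0 = 1 := χ.one_of_mem_closedBall (by simp [χ])
    simp [this]
  have hB0 : 0 ≤ B := integral_nonneg fun _ => sq_nonneg _
  obtain ⟨M, hM⟩ := exists_gt (max 1 (B / (δ * A)))
  have hM1 : 1 < M := (le_max_left _ _).trans_lt hM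
  have hM0 : 0 < M := by linarith
  have hMB : B < M * (δ * A) := by
    have := (le_max_right _ _).trans_lt hM
    rwa [div_lt_iff₀ (by positivity)] at this
  have hd : ∀ s, deriv (fun s => χ (s / M)) s = deriv χ (s / M) / M := fun s => by
    have h1 : HasDerivAt (fun s : ℝ => s / M) (1 / M) s := (hasDerivAt_id s).div_const M
    have h2 := (hχ.differentiable (by simp) (s / M)).hasDerivAt.comp s h1
    rw [HasDerivAt.deriv (f := fun s => χ (s / M)) h2]
    ring
  have e1 : ∫ s, χ (s / M) ^ 2 = M * A := by
    rw [Measure.integral_comp_div (fun s => χ s ^ 2) M, abs_of_pos hM0, smul_eq_mul]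
  have e2 : ∫ s, deriv (fun s => χ (s / M)) s ^ 2 = M⁻¹ * B := by
    simp_rw [hd, div_pow]
    rw [integral_div, Measure.integral_comp_div (fun s => deriv χ s ^ 2) M, abs_of_pos hM0, smul_eq_mul]
    field_simp
    rfl
  refine ⟨fun s => χ (s / M), hχ.comp (contDiff_id.div_const M), ?_, ?_, ?_⟩
  · exact χ.hasCompactSupport.comp_isClosedEmbedding
      (Homeomorph.mulRight₀ M⁻¹ (inv_ne_zero hM0.ne')).isClosedEmbedding
  · rw [e1]; positivity
  · rw [e1, e2, inv_mul_le_iff₀ hM0]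
    nlinarith [mul_pos hδ hA0, mul_pos hM0 (mul_pos hδ hA0)]

/-- A normal profile, which agrees with the Robin ground state `e^{-t}` of the half line up to a
distant cutoff. -/
theorem exists_normal_profile {δ : ℝ} (hδ : 0 < δ) (hδ1 : δ < 1) :
    ∃ b : ℝ → ℝ, ContDiff ℝ ∞ b ∧ HasCompactSupport b ∧ ∃ η : ℝ, 0 < η ∧
      ∫ t in Set.Ioi (-η), b t ^ 2 ≤ (1 + δ) / 2 ∧
      ∫ t in Set.Ioi (-η), deriv b t ^ 2 ≤ (1 + δ) / 2 ∧
      ∀ t, |t| ≤ η → 1 - δ ≤ b t ^ 2 := by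
  let χ : ContDiffBump (0 : ℝ) := ⟨1, 2, one_pos, one_lt_two⟩
  have hχ : ContDiff ℝ ∞ χ := χ.contDiff
  have hχ' : Continuous (deriv χ) := hχ.continuous_deriv (by simp)
  obtain ⟨B, hB⟩ := (χ.hasCompactSupport.deriv).exists_bound_of_continuous hχ'
  have hB0 : 0 ≤ B := (norm_nonneg _).trans (hB 0)
  obtain ⟨T, hT1, hT⟩ : ∃ T : ℝ, 1 ≤ T ∧ (1 + B / T) ^ 2 ≤ 1 + δ / 3 := by
    have h1 : Tendsto (fun T : ℝ => (1 + B / T) ^ 2) atTop (𝓝 1) := by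
      simpa using ((tendsto_const_nhds (x := (1 : ℝ))).add
        (tendsto_id.const_div_atTop B)).pow 2
    obtain ⟨T, h2, h3⟩ := ((h1.eventually (ge_mem_nhds (by linarith : 1 < 1 + δ / 3))).and
      (eventually_ge_atTop 1)).exists
    exact ⟨T, h3, h2⟩
  have hT0 : 0 < T := by linarith
  obtain ⟨η, hη0, hη1, hη2, hη3⟩ : ∃ η : ℝ, 0 < η ∧ η ≤ 1 ∧ Real.exp (2 * η) ≤ 1 + δ / 3 ∧
      1 - δ ≤ Real.exp (-2 * η) := by
    have h1 : Tendsto (fun η : ℝ => Real.exp (2 * η)) (𝓝[>] 0) (𝓝 1) := by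
      have : Continuous fun η : ℝ => Real.exp (2 * η) := by fun_prop
      simpa using (this.tendsto 0).mono_left nhdsWithin_le_nhds
    have h2 : Tendsto (fun η : ℝ => Real.exp (-2 * η)) (𝓝[>] 0) (𝓝 1) := by
      have : Continuous fun η : ℝ => Real.exp (-2 * η) := by fun_prop
      simpa using (this.tendsto 0).mono_left nhdsWithin_le_nhds
    obtain ⟨η, h3, h4, h5⟩ := ((h1.eventually (ge_mem_nhds (by linarith : 1 < 1 + δ / 3))).and
      ((h2.eventually (le_mem_nhds (by linarith : 1 - δ < 1))).and
        (Ioc_mem_nhdsGT (zero_lt_one' ℝ)))).exists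
    exact ⟨η, h5.1, h5.2, h3, h4⟩
  set b : ℝ → ℝ := fun t => χ (t / T) * Real.exp (-t) with hb
  have hd : ∀ t, deriv b t = (deriv χ (t / T) / T - χ (t / T)) * Real.exp (-t) := fun t => by
    have h1 : HasDerivAt (fun s : ℝ => s / T) (1 / T) t := (hasDerivAt_id t).div_const T
    have h2 := (hχ.differentiable (by simp) (t / T)).hasDerivAt.comp t h1
    have h3 : HasDerivAt (fun t : ℝ => Real.exp (-t)) (Real.exp (-t) * -1) t :=
      (hasDerivAt_neg t).exp
    rw [HasDerivAt.deriv (f := b) (h2.mul h3)]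
    simp only [Function.comp_apply]
    ring
  have hbs : ContDiff ℝ ∞ b :=
    (hχ.comp (contDiff_id.div_const T)).mul (Real.contDiff_exp.comp contDiff_neg)
  have hbc : HasCompactSupport b := HasCompactSupport.mul_right (χ.hasCompactSupport.comp_isClosedEmbedding
      (Homeomorph.mulRight₀ T⁻¹ (inv_ne_zero hT0.ne')).isClosedEmbedding)
  have hexp : IntegrableOn (fun t : ℝ => Real.exp (-2 * t)) (Set.Ioi (-η)) :=
    integrableOn_exp_mul_Ioi (by norm_num) _
  have hexpI : ∫ t in Set.Ioi (-η), Real.exp (-2 * t) = Real.exp (2 * η) / 2 := by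
    rw [integral_exp_mul_Ioi (by norm_num)]
    ring_nf
  have hsq : ∀ t : ℝ, Real.exp (-t) ^ 2 = Real.exp (-2 * t) := fun t => by
    rw [← Real.exp_nat_mul]; congr 1; push_cast; ring
  have hb1 : ∀ t, b t ^ 2 ≤ Real.exp (-2 * t) := fun t => by
    rw [hb, mul_pow, hsq]
    refine mul_le_of_le_one_left (Real.exp_nonneg _) (pow_le_one₀ χ.nonneg χ.le_one)
  have hb2 : ∀ t, deriv b t ^ 2 ≤ (1 + δ / 3) * Real.exp (-2 * t) := fun t => by
    rw [hd, mul_pow, hsq]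
    refine mul_le_mul_of_nonneg_right (le_trans ?_ hT) (Real.exp_nonneg _)
    refine sq_le_sq' ?_ ?_
    · have := abs_le.1 ((Real.norm_eq_abs _).symm ▸ hB (t / T))
      have h4 : -(B / T) ≤ deriv χ (t / T) / T := by
        rw [← neg_div]; exact div_le_div_of_nonneg_right this.1 hT0.le
      linarith [χ.le_one (x := t / T)]
    · have := abs_le.1 ((Real.norm_eq_abs _).symm ▸ hB (t / T))
      have h4 : deriv χ (t / T) / T ≤ B / T := div_le_div_of_nonneg_right this.2 hT0.le
      linarith [χ.nonneg (x := t / T)]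
  refine ⟨b, hbs, hbc, η, hη0, ?_, ?_, fun t ht => ?_⟩
  · calc _ ≤ ∫ t in Set.Ioi (-η), Real.exp (-2 * t) :=
          integral_mono_of_nonneg (Eventually.of_forall fun _ => sq_nonneg _) hexp
            (Eventually.of_forall hb1)
      _ ≤ _ := by rw [hexpI]; linarith
  · calc _ ≤ ∫ t in Set.Ioi (-η), (1 + δ / 3) * Real.exp (-2 * t) :=
          integral_mono_of_nonneg (Eventually.of_forall fun _ => sq_nonneg _) (hexp.const_mul _)
            (Eventually.of_forall hb2)
      _ ≤ _ := by
          rw [integral_const_mul, hexpI]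
          nlinarith
  · have h1 : χ (t / T) = 1 := by
      refine χ.one_of_mem_closedBall ?_
      rw [mem_closedBall_zero_iff, Real.norm_eq_abs, abs_div, abs_of_pos hT0,
        div_le_iff₀ hT0]
      change |t| ≤ 1 * T
      linarith
    rw [hb]
    simp only [h1, one_mul]
    rw [hsq]
    refine hη3.trans (Real.exp_le_exp.2 ?_)
    linarith [(abs_le.1 ht).2]

end Profile

/-! ### Trial functions at a boundary point -/

section TrialFunction

variable {Ω : Set Plane} {p n : Plane}

theorem hasFDerivAt_inner_sub (v p x : Plane) :
    HasFDerivAt (fun y => inner ℝ v (y - p)) (innerSL ℝ v) x :=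
  (innerSL ℝ v).hasFDerivAt.comp x ((hasFDerivAt_id x).sub_const p)

/-- A function of product form in the frame at `p`, at the scale `σ`. -/
noncomputable def frameProd (p n : Plane) (σ : ℝ) (a b : ℝ → ℝ) (x : Plane) : ℝ :=
  a (σ⁻¹ * tangential p n x) * b (σ⁻¹ * inner ℝ n (x - p))

theorem contDiff_frameProd {a b : ℝ → ℝ} (ha : ContDiff ℝ ∞ a) (hb : ContDiff ℝ ∞ b) (p n : Plane)
    (σ : ℝ) : ContDiff ℝ ∞ (frameProd p n σ a b) := by
  have h : ∀ v : Plane, ContDiff ℝ ∞ fun x : Plane => (inner ℝ v (x - p) : ℝ) := fun v =>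
    (innerSL ℝ v).contDiff.comp (contDiff_id.sub contDiff_const)
  exact (ha.comp (contDiff_const.mul (h (turn n)))).mul (hb.comp (contDiff_const.mul (h n)))

theorem hasFDerivAt_frameProd {a b : ℝ → ℝ} (ha : Differentiable ℝ a) (hb : Differentiable ℝ b)
    (p n : Plane) (σ : ℝ) (x : Plane) :
    HasFDerivAt (frameProd p n σ a b)
      ((σ⁻¹ * (a (σ⁻¹ * tangential p n x) * deriv b (σ⁻¹ * inner ℝ n (x - p)))) • innerSL ℝ n
        + (σ⁻¹ * (deriv a (σ⁻¹ * tangential p n x) * b (σ⁻¹ * inner ℝ n (x - p)))) •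
          innerSL ℝ (turn n)) x := by
  have h1 := (ha (σ⁻¹ * tangential p n x)).hasDerivAt.comp_hasFDerivAt x
    ((hasFDerivAt_inner_sub (turn n) p x).const_mul σ⁻¹)
  have h2 := (hb (σ⁻¹ * inner ℝ n (x - p))).hasDerivAt.comp_hasFDerivAt x
    ((hasFDerivAt_inner_sub n p x).const_mul σ⁻¹)
  refine (h1.mul h2).congr_fderiv ?_
  ext v
  simp [tangential]
  ring

theorem norm_sub_le_of_abs_lt (hn : ‖n‖ = 1) {σ R : ℝ} (hσ : 0 < σ) {x : Plane}
    (hs : |σ⁻¹ * tangential p n x| < R) (ht : |σ⁻¹ * inner ℝ n (x - p)| < R) :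
    ‖x - p‖ ≤ 2 * R * σ := by
  have h1 : |tangential p n x| < R * σ := by
    rwa [abs_mul, abs_of_pos (inv_pos.2 hσ), inv_mul_lt_iff₀ hσ, mul_comm] at hs
  have h2 : |inner ℝ n (x - p)| < R * σ := by
    rwa [abs_mul, abs_of_pos (inv_pos.2 hσ), inv_mul_lt_iff₀ hσ, mul_comm] at ht
  have h3 := sq_inner_turn_add_sq_inner hn (x - p)
  rw [tangential] at h1
  have h4 := (abs_nonneg _).trans_lt h1
  rw [← sq_abs, ← sq_abs (inner ℝ n (x - p))] at h3
  refine abs_le_of_sq_le_sq' ?_ (by linarith) |>.2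
  nlinarith [abs_nonneg (inner ℝ (turn n) (x - p)), abs_nonneg (inner ℝ n (x - p))]

/-- The magnetic gradient of `e^{iθ} f`, for real `θ` and `f`. -/
theorem norm_sq_magneticGrad_gauge {h ζ : ℝ} {θ f : Plane → ℝ} {θ' f' : Plane →L[ℝ] ℝ} {x : Plane}
    (hθ : HasFDerivAt θ θ' x) (hf : HasFDerivAt f f' x) (j : Fin 2) :
    ‖magneticGrad h ζ (fun y => Complex.exp (θ y * Complex.I) * f y) j x‖ ^ 2 =
      h ^ 2 * f' (EuclideanSpace.single j 1) ^ 2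
        + (h * θ' (EuclideanSpace.single j 1) - ζ * A₀ x j) ^ 2 * f x ^ 2 := by
  have h1 : HasFDerivAt (fun y => (θ y : ℂ) * Complex.I)
      (Complex.I • (Complex.ofRealCLM ∘L θ')) x :=
    (Complex.ofRealCLM.hasFDerivAt.comp x hθ).mul_const Complex.I
  have h2 : HasFDerivAt (fun y => (f y : ℂ)) (Complex.ofRealCLM ∘L f') x :=
    Complex.ofRealCLM.hasFDerivAt.comp x hf
  have h3 := h1.cexp.mul h2
  have e : magneticGrad h ζ (fun y => Complex.exp (θ y * Complex.I) * f y) j x =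
      Complex.exp (θ x * Complex.I) * ((h * f' (EuclideanSpace.single j 1) : ℝ)
        + ((h * θ' (EuclideanSpace.single j 1) - ζ * A₀ x j) * f x : ℝ) * Complex.I) := by
    unfold magneticGrad partialDeriv
    rw [HasFDerivAt.fderiv (f := fun y => Complex.exp (θ y * Complex.I) * f y) h3]
    simp
    ring
  rw [e, norm_mul, Complex.norm_exp_ofReal_mul_I, one_mul, ← Complex.normSq_eq_norm_sq,
    Complex.normSq_add_mul_I]
  ring

theorem lintegral_ofReal_scale {σ : ℝ} (hσ : 0 < σ) {H : ℝ → ℝ} (hH : Integrable H)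
    (hH0 : ∀ s, 0 ≤ H s) :
    ∫⁻ s, ENNReal.ofReal (H (σ⁻¹ * s)) = ENNReal.ofReal (σ * ∫ s, H s) := by
  rw [← ofReal_integral_eq_lintegral_ofReal (hH.comp_mul_left' (inv_ne_zero hσ.ne'))
    (Eventually.of_forall fun s => hH0 _), Measure.integral_comp_mul_left, inv_inv,
    abs_of_pos hσ, smul_eq_mul]

theorem setLIntegral_le_of_le_prod (hΩ : IsOpen Ω) (p : Plane) (hn : ‖n‖ = 1) {σ : ℝ} (hσ : 0 < σ)
    {F G : ℝ → ℝ} (hF : Integrable F) (hG : Integrable G) (hF0 : ∀ s, 0 ≤ F s)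
    (hG0 : ∀ t, 0 ≤ G t) (hFm : Measurable F) (hGm : Measurable G) {k : Plane → ℝ}
    (hk : ∀ x ∈ Ω, k x ≤ F (σ⁻¹ * tangential p n x) * G (σ⁻¹ * inner ℝ n (x - p))) :
    ∫⁻ x in Ω, ENNReal.ofReal (k x) ≤ ENNReal.ofReal (σ ^ 2 * ((∫ s, F s) * ∫ t, G t)) := by
  set P : Plane → ℝ≥0∞ := fun x => ENNReal.ofReal (F (σ⁻¹ * tangential p n x)) *
    ENNReal.ofReal (G (σ⁻¹ * inner ℝ n (x - p))) with hP
  have hPm : Measurable P := by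
    have h1 : Measurable (tangential p n) := (continuous_tangential p n).measurable
    have h2 : Measurable fun x : Plane => (inner ℝ n (x - p) : ℝ) :=
      (by fun_prop : Continuous fun x : Plane => (inner ℝ n (x - p) : ℝ)).measurable
    fun_prop
  calc _ ≤ ∫⁻ x in Ω, P x := by
        refine setLIntegral_mono' hΩ.measurableSet fun x hx => ?_
        simp only [hP]
        rw [← ENNReal.ofReal_mul (hF0 _)]
        exact ENNReal.ofReal_le_ofReal (hk x hx)
    _ ≤ ∫⁻ x, P x := setLIntegral_le_lintegral _ _
    _ = ∫⁻ s, ENNReal.ofReal (F (σ⁻¹ * s)) * ∫⁻ t, ENNReal.ofReal (G (σ⁻¹ * t)) := by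
        rw [lintegral_eq_frame p hn hPm]
        refine lintegral_congr fun s => ?_
        rw [← lintegral_const_mul _ (by fun_prop)]
        refine lintegral_congr fun t => ?_
        simp only [hP, tangential, inner_turn_framePoint hn, inner_framePoint hn]
    _ = _ := by
        rw [lintegral_mul_const _ (by fun_prop), lintegral_ofReal_scale hσ hF hF0,
          lintegral_ofReal_scale hσ hG hG0,
          ← ENNReal.ofReal_mul (mul_nonneg hσ.le (integral_nonneg hF0))]
        congr 1
        ring

end TrialFunction

/-! ### Integrals of trial functions -/

section TrialBounds

variable {Ω : Set Plane} {p n : Plane} {η r σ R ηc : ℝ} {ψ : Plane → ℝ}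

/-- At the scale `σ` of the trial function, the domain lies above height `-ησ`. -/
theorem IsFlatChart.lt_inner (hc : IsFlatChart Ω p n ηc r ψ) (hn : ‖n‖ = 1) (hσ : 0 < σ)
    (hη : 0 < η) (hηc : 0 ≤ ηc) (hηR : 4 * R * ηc ≤ η) (hσr : 2 * R * σ < r) {x : Plane}
    (hx : x ∈ Ω) (hs : |σ⁻¹ * tangential p n x| < R) (ht : |σ⁻¹ * inner ℝ n (x - p)| < R) :
    -η < σ⁻¹ * inner ℝ n (x - p) := by
  have h1 := norm_sub_le_of_abs_lt hn hσ hs ht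
  have h2 := hc.le_inner (mem_ball_iff_norm.2 (h1.trans_lt hσr)) hx
  rw [lt_inv_mul_iff₀ hσ]
  have h3 := mul_le_mul_of_nonneg_left h1 hηc
  nlinarith

/-- The square integrals over the domain of functions of product form are controlled by those over
the half plane above height `-η`. -/
theorem IsFlatChart.setLIntegral_prod_le (hΩ : IsOpen Ω) (hc : IsFlatChart Ω p n ηc r ψ)
    (hn : ‖n‖ = 1) (hσ : 0 < σ) (hη : 0 < η) (hηc : 0 ≤ ηc) (hηR : 4 * R * ηc ≤ η)
    (hσr : 2 * R * σ < r) {a b : ℝ → ℝ} (ha : Continuous a) (hb : Continuous b)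
    (haR : ∀ s, R ≤ |s| → a s = 0) (hbR : ∀ s, R ≤ |s| → b s = 0) :
    ∫⁻ x in Ω, ENNReal.ofReal (a (σ⁻¹ * tangential p n x) ^ 2 * b (σ⁻¹ * inner ℝ n (x - p)) ^ 2) ≤
      ENNReal.ofReal (σ ^ 2 * ((∫ s, a s ^ 2) * ∫ t in Set.Ioi (-η), b t ^ 2)) := by
  have hcs : ∀ {f : ℝ → ℝ}, (∀ s, R ≤ |s| → f s = 0) → HasCompactSupport (fun s => f s ^ 2) :=
    fun {f} hf => HasCompactSupport.intro (isCompact_Icc (a := -R) (b := R)) fun s hs => by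
      have : R ≤ |s| := by
        by_contra h
        exact hs (abs_le.1 (not_le.1 h).le)
      simp [hf s this]
  rw [← integral_indicator measurableSet_Ioi]
  refine setLIntegral_le_of_le_prod (F := fun s => a s ^ 2)
    (G := (Set.Ioi (-η)).indicator fun t => b t ^ 2) hΩ p hn hσ
    ((ha.pow 2).integrable_of_hasCompactSupport (hcs haR))
    (((hb.pow 2).integrable_of_hasCompactSupport (hcs hbR)).indicator measurableSet_Ioi)
    (fun _ => sq_nonneg _) (fun _ => Set.indicator_nonneg (fun _ _ => sq_nonneg _) _)
    (ha.pow 2).measurable ((hb.pow 2).measurable.indicator measurableSet_Ioi) fun x hx => ?_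
  by_cases hs : R ≤ |σ⁻¹ * tangential p n x|
  · simp [haR _ hs]
  by_cases ht : R ≤ |σ⁻¹ * inner ℝ n (x - p)|
  · rw [hbR _ ht, zero_pow two_ne_zero, mul_zero]
    exact mul_nonneg (sq_nonneg _) (Set.indicator_nonneg (fun _ _ => sq_nonneg _) _)
  rw [Set.indicator_of_mem]
  exact hc.lt_inner hn hσ hη hηc hηR hσr hx (not_le.1 hs) (not_le.1 ht)

/-- The boundary integral of the trial function is controlled from below, because the tangential
projection of the boundary is onto and does not increase lengths. -/
theorem IsFlatChart.le_lintegral_arcLength (hc : IsFlatChart Ω p n ηc r ψ) (hn : ‖n‖ = 1)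
    (hσ : 0 < σ) (hηc : ηc ∈ Set.Ioo 0 (1 / 2)) (hηR : 4 * R * ηc ≤ η) (hR : 0 < R)
    (hσr : 2 * R * σ < r) {a b : ℝ → ℝ} (ha : Continuous a) (haR : ∀ s, R ≤ |s| → a s = 0)
    {m : ℝ} (hm : 0 ≤ m) (hbm : ∀ t, |t| ≤ η → m ≤ b t ^ 2) :
    ENNReal.ofReal (m * (σ * ∫ s, a s ^ 2)) ≤
      ∫⁻ x, ENNReal.ofReal (a (σ⁻¹ * tangential p n x) ^ 2 * b (σ⁻¹ * inner ℝ n (x - p)) ^ 2)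
        ∂arcLength Ω := by
  set S : Set Plane := frontier Ω ∩ {x | |σ⁻¹ * inner ℝ n (x - p)| ≤ η} with hS
  have hSm : MeasurableSet S := isClosed_frontier.measurableSet.inter
    (isClosed_le (by fun_prop) continuous_const).measurableSet
  have hI : Set.Ioo (-(R * σ)) (R * σ) ⊆ tangential p n '' S := fun s hs => by
    have hs' : |s| < R * σ := abs_lt.2 hs
    obtain ⟨t, ht, htf⟩ := hc.exists_frontier hn hηc (s := s) (by linarith)
    refine ⟨_, ⟨htf, ?_⟩, inner_turn_framePoint hn (s, t)⟩
    rw [Set.mem_ofPred_eq, inner_framePoint hn, abs_mul, abs_of_pos (inv_pos.2 hσ),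
      inv_mul_le_iff₀ hσ]
    have h1 := mul_le_mul_of_nonneg_left hs'.le hηc.1.le
    have h2 := mul_pos (mul_pos hR hσ) hηc.1
    nlinarith
  have hcs : HasCompactSupport (fun s => a s ^ 2) :=
    HasCompactSupport.intro (isCompact_Icc (a := -R) (b := R)) fun s hs => by
      have : R ≤ |s| := by
        by_contra h
        exact hs (abs_le.1 (not_le.1 h).le)
      simp [haR s this]
  have hK : Measurable fun s => ENNReal.ofReal (m * a (σ⁻¹ * s) ^ 2) := by
    have := ha.measurable
    fun_prop
  calc ENNReal.ofReal (m * (σ * ∫ s, a s ^ 2))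
      = ∫⁻ s, ENNReal.ofReal (m * a (σ⁻¹ * s) ^ 2) := by
        simp_rw [ENNReal.ofReal_mul hm]
        rw [lintegral_const_mul' _ _ ENNReal.ofReal_ne_top, lintegral_ofReal_scale
          (H := fun s => a s ^ 2) hσ ((ha.pow 2).integrable_of_hasCompactSupport hcs)
          fun s => sq_nonneg _]
    _ = ∫⁻ s in Set.Ioo (-(R * σ)) (R * σ), ENNReal.ofReal (m * a (σ⁻¹ * s) ^ 2) := by
        rw [← lintegral_indicator measurableSet_Ioo]
        refine lintegral_congr fun s => ?_
        by_cases hs : s ∈ Set.Ioo (-(R * σ)) (R * σ)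
        · rw [Set.indicator_of_mem hs]
        · rw [Set.indicator_of_notMem hs, haR, zero_pow two_ne_zero, mul_zero, ENNReal.ofReal_zero]
          rw [abs_mul, abs_of_pos (inv_pos.2 hσ), le_inv_mul_iff₀ hσ, mul_comm]
          by_contra h
          exact hs (abs_lt.1 (not_le.1 h))
    _ ≤ ∫⁻ x in S, ENNReal.ofReal (m * a (σ⁻¹ * tangential p n x) ^ 2) ∂μH[1] :=
        setLIntegral_le_lintegral_tangential p hn hI hK
    _ ≤ ∫⁻ x in S, ENNReal.ofReal (a (σ⁻¹ * tangential p n x) ^ 2 *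
          b (σ⁻¹ * inner ℝ n (x - p)) ^ 2) ∂μH[1] := by
        refine setLIntegral_mono' hSm fun x hx => ENNReal.ofReal_le_ofReal ?_
        rw [mul_comm]
        exact mul_le_mul_of_nonneg_left (hbm _ hx.2) (sq_nonneg _)
    _ ≤ _ := lintegral_mono_set Set.inter_subset_left

theorem sum_sq_apply_single (hn : ‖n‖ = 1) (c d : ℝ) :
    ∑ j, ((c • innerSL ℝ n + d • innerSL ℝ (turn n) : Plane →L[ℝ] ℝ)
      (EuclideanSpace.single j 1)) ^ 2 = c ^ 2 + d ^ 2 := by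
  have h1 : n 0 ^ 2 + n 1 ^ 2 = 1 := by rw [← norm_sq_plane, hn]; norm_num
  rw [Fin.sum_univ_two]
  simp [turn, EuclideanSpace.inner_single_right]
  linear_combination (c ^ 2 + d ^ 2) * h1

end TrialBounds

/-! ### The upper bound of the ground state energy -/

section GroundStateEnergy

variable {Ω : Set Plane}

/-- The leading order upper bound of the ground state energy. The trial function is
`e^{-t/√h}` in the distance `t` to the tangent at a boundary point `p`, with cutoffs at a large
multiple of `√h`, in the gauge in which the potential vanishes at `p`. -/
theorem IsC3Domain.groundStateEnergy_le (hΩ : IsC3Domain Ω) {δ c ε : ℝ} (hδ : 0 < δ)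
    (hδ1 : δ ≤ 1 / 8) (hε : 0 < ε) :
    ∃ h₀ ∈ Set.Ioo (0 : ℝ) 1, ∀ h ∈ Set.Ioo (0 : ℝ) h₀, ∀ ζ ∈ Set.Ioo 0 (c * h ^ ε), ∀ lam : ℝ,
      IsGroundStateEnergy Ω h ζ lam → lam ≤ -((1 - 8 * δ) * h) := by
  obtain ⟨p, hp⟩ := hΩ.frontier_nonempty
  obtain ⟨n, hn, hchart⟩ := hΩ.exists_flatChart hp
  obtain ⟨a, has, hac, hA0, hA1⟩ := exists_tangential_profile hδ
  obtain ⟨b, hbs, hbc, η, hη, hB0, hB1, hbm⟩ := exists_normal_profile hδ (by linarith)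
  obtain ⟨R₁, hR₁0, hR₁⟩ := exists_forall_abs_ge_eq_zero hac
  obtain ⟨R₂, hR₂0, hR₂⟩ := exists_forall_abs_ge_eq_zero hbc
  set R := max R₁ R₂ with hRdef
  have hR : 0 < R := lt_max_of_lt_left hR₁0
  replace hR₁ : ∀ s, R ≤ |s| → a s = 0 ∧ deriv a s = 0 := fun s hs =>
    hR₁ s ((le_max_left _ _).trans hs)
  replace hR₂ : ∀ s, R ≤ |s| → b s = 0 ∧ deriv b s = 0 := fun s hs =>
    hR₂ s ((le_max_right _ _).trans hs)
  -- On the support of the trial function, at distance at most `2 R √h` from `p`, a chart of flatness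
  -- `ηc` keeps the boundary within `η √h` of the tangent.
  set ηc : ℝ := min (1 / 4) (η / (4 * R)) with hηcdef
  have hηc : ηc ∈ Set.Ioo (0 : ℝ) (1 / 2) :=
    ⟨by positivity, (min_le_left _ _).trans_lt (by norm_num)⟩
  have hηR : 4 * R * ηc ≤ η := by
    have : ηc ≤ η / (4 * R) := min_le_right _ _
    rw [le_div_iff₀ (by positivity)] at this
    linarith
  obtain ⟨r, ψ, hc⟩ := hchart ηc ⟨hηc.1, by linarith [hηc.2]⟩
  have hr := hc.r_pos
  have := hΩ.isFiniteMeasure_arcLength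
  obtain ⟨K, -, hform⟩ := hΩ.exists_form_bound
  obtain ⟨h₀, hh₀0, hh₀⟩ : ∃ h₀ : ℝ, 0 < h₀ ∧ ∀ h ∈ Set.Ioo (0 : ℝ) h₀,
      2 * R * Real.sqrt h < r ∧ (c * h ^ ε) ^ 2 * (4 * R ^ 2) ≤ δ := by
    have h1 : Tendsto (fun h : ℝ => 2 * R * Real.sqrt h) (𝓝[>] 0) (𝓝 0) := by
      have : Continuous fun h : ℝ => 2 * R * Real.sqrt h := by fun_prop
      simpa using (this.tendsto 0).mono_left nhdsWithin_le_nhds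
    have h2 : Tendsto (fun h : ℝ => (c * h ^ ε) ^ 2 * (4 * R ^ 2)) (𝓝[>] 0) (𝓝 0) := by
      have : Continuous fun h : ℝ => (c * h ^ ε) ^ 2 * (4 * R ^ 2) := by
        have := Real.continuous_rpow_const hε.le
        fun_prop
      simpa [Real.zero_rpow hε.ne'] using (this.tendsto 0).mono_left nhdsWithin_le_nhds
    obtain ⟨h₀, h3, h4⟩ := mem_nhdsGT_iff_exists_Ioo_subset.1
      ((h1.eventually (gt_mem_nhds hr)).and (h2.eventually (ge_mem_nhds hδ)))
    exact ⟨h₀, h3, fun h hh => h4 hh⟩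
  refine ⟨min h₀ (1 / 2), ⟨by positivity, (min_le_right _ _).trans_lt (by norm_num)⟩,
    fun h hh ζ hζ lam hlam => ?_⟩
  have hh0 : 0 < h := hh.1
  have hh1 : h < 1 := hh.2.trans_le ((min_le_right _ _).trans (by norm_num))
  obtain ⟨hσr, hζR⟩ := hh₀ h ⟨hh0, hh.2.trans_le (min_le_left _ _)⟩
  have hσ : 0 < Real.sqrt h := Real.sqrt_pos.2 hh0
  have hσ2 : Real.sqrt h ^ 2 = h := Real.sq_sqrt hh0.le
  have hκ : h ^ (3 / 2 : ℝ) = h * Real.sqrt h := by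
    rw [show (3 / 2 : ℝ) = 1 + 1 / 2 by norm_num, Real.rpow_add hh0, Real.rpow_one,
      Real.sqrt_eq_rpow]
  generalize Real.sqrt h = σ at hσr hσ hσ2 hκ
  have hζ2 : ζ ^ 2 * (4 * R ^ 2) ≤ δ := by
    refine le_trans (mul_le_mul_of_nonneg_right ?_ (by positivity)) hζR
    exact pow_le_pow_left₀ hζ.1.le hζ.2.le 2
  set θ : Plane → ℝ := fun x => h⁻¹ * ζ * inner ℝ (A₀ p) x with hθ
  set f : Plane → ℝ := frameProd p n σ a b with hf
  set φ : Plane → ℂ := fun x => Complex.exp (θ x * Complex.I) * f x with hφ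
  have hfs : ContDiff ℝ ∞ f := contDiff_frameProd has hbs p n σ
  have hθs : ContDiff ℝ ∞ θ := contDiff_const.mul (innerSL ℝ (A₀ p)).contDiff
  have hφs : ContDiff ℝ ∞ φ :=
    ((Complex.ofRealCLM.contDiff.comp hθs).mul contDiff_const).cexp.mul
      (Complex.ofRealCLM.contDiff.comp hfs)
  have hf0 : ∀ x, f x ≠ 0 → ‖x - p‖ ≤ 2 * R * σ := fun x hx => by
    have h1 := left_ne_zero_of_mul hx
    have h2 := right_ne_zero_of_mul hx
    exact norm_sub_le_of_abs_lt hn hσ (not_le.1 fun h => h1 (hR₁ _ h).1)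
      (not_le.1 fun h => h2 (hR₂ _ h).1)
  have hφc : HasCompactSupport φ := by
    refine HasCompactSupport.intro (isCompact_closedBall p (2 * R * σ)) fun x hx => ?_
    have : f x = 0 := by
      by_contra h
      exact hx (mem_closedBall_iff_norm.2 (hf0 x h))
    simp [hφ, this]
  have hφn : ∀ x, ‖φ x‖ ^ 2 =
      a (σ⁻¹ * tangential p n x) ^ 2 * b (σ⁻¹ * inner ℝ n (x - p)) ^ 2 := fun x => by
    rw [hφ, norm_mul, Complex.norm_exp_ofReal_mul_I, one_mul, Complex.norm_real,
      Real.norm_eq_abs, sq_abs, hf, frameProd, mul_pow]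
  have hGn : ∀ x, ∑ j, ‖magneticGrad h ζ φ j x‖ ^ 2 ≤
      h * (a (σ⁻¹ * tangential p n x) ^ 2 * deriv b (σ⁻¹ * inner ℝ n (x - p)) ^ 2)
      + h * (deriv a (σ⁻¹ * tangential p n x) ^ 2 * b (σ⁻¹ * inner ℝ n (x - p)) ^ 2)
      + δ * h * (a (σ⁻¹ * tangential p n x) ^ 2 * b (σ⁻¹ * inner ℝ n (x - p)) ^ 2) := fun x => by
    have hθd : HasFDerivAt θ ((h⁻¹ * ζ) • innerSL ℝ (A₀ p)) x :=
      (innerSL ℝ (A₀ p)).hasFDerivAt.const_mul _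
    have hfd := hasFDerivAt_frameProd (has.differentiable (by simp)) (hbs.differentiable (by simp))
      p n σ x
    have hA : ∀ j, h * ((h⁻¹ * ζ) • innerSL ℝ (A₀ p)) (EuclideanSpace.single j (1 : ℝ)) - ζ * A₀ x j
        = ζ * (A₀ p j - A₀ x j) := fun j => by
      simp [EuclideanSpace.inner_single_right]
      field_simp
    have hfx : (ζ * (p 1 - x 1)) ^ 2 * f x ^ 2 ≤ δ * h * f x ^ 2 := by
      by_cases hx : f x = 0
      · simp [hx]
      refine mul_le_mul_of_nonneg_right ?_ (sq_nonneg _)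
      have h1 : (p 1 - x 1) ^ 2 ≤ (2 * R * σ) ^ 2 := by
        rw [← sq_abs]
        refine pow_le_pow_left₀ (abs_nonneg _) ?_ 2
        rw [abs_sub_comm]
        exact (PiLp.norm_apply_le (x - p) 1).trans (hf0 x hx)
      calc (ζ * (p 1 - x 1)) ^ 2 = ζ ^ 2 * (p 1 - x 1) ^ 2 := mul_pow _ _ _
        _ ≤ ζ ^ 2 * (2 * R * σ) ^ 2 := mul_le_mul_of_nonneg_left h1 (sq_nonneg _)
        _ = ζ ^ 2 * (4 * R ^ 2) * h := by rw [← hσ2]; ring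
        _ ≤ δ * h := mul_le_mul_of_nonneg_right hζ2 hh0.le
    have e0 : ∀ j, ‖magneticGrad h ζ φ j x‖ ^ 2 = _ := fun j =>
      norm_sq_magneticGrad_gauge hθd hfd j
    rw [Finset.sum_congr rfl fun j _ => e0 j]
    simp_rw [hA]
    rw [Finset.sum_add_distrib, ← Finset.mul_sum, sum_sq_apply_single hn, Fin.sum_univ_two]
    have e1 : (f x) ^ 2 =
      a (σ⁻¹ * tangential p n x) ^ 2 * b (σ⁻¹ * inner ℝ n (x - p)) ^ 2 := by
      rw [hf, frameProd, mul_pow]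
    have e2 : h ^ 2 * σ⁻¹ ^ 2 = h := by
      rw [← hσ2]; field_simp
    have e3 : A₀ p 0 - A₀ x 0 = -(p 1 - x 1) := by simp [A₀]; ring
    have e4 : A₀ p 1 - A₀ x 1 = 0 := by simp [A₀]
    rw [e3, e4, ← e1]
    generalize σ⁻¹ = τ at *
    have e5 : h ^ 2 * ((τ * (a (τ * tangential p n x) * deriv b (τ * inner ℝ n (x - p)))) ^ 2
        + (τ * (deriv a (τ * tangential p n x) * b (τ * inner ℝ n (x - p)))) ^ 2) =
        (h ^ 2 * τ ^ 2) * (a (τ * tangential p n x) ^ 2 * deriv b (τ * inner ℝ n (x - p)) ^ 2)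
        + (h ^ 2 * τ ^ 2) * (deriv a (τ * tangential p n x) ^ 2 * b (τ * inner ℝ n (x - p)) ^ 2) := by
      ring
    rw [e5, e2]
    change _ + ((ζ * -(p 1 - x 1)) ^ 2 * f x ^ 2 + (ζ * 0) ^ 2 * f x ^ 2) ≤ _
    linarith
  set X := smoothTriple Ω h ζ φ hφs hφc with hX
  have hXmem := smoothTriple_mem Ω h ζ φ hφs hφc
  have hXfn : X.fn =ᵐ[volume.restrict Ω] φ :=
    (hφs.continuous.memLp_of_hasCompactSupport hφc).coeFn_toLp
  have hXgrad : ∀ j, X.grad j =ᵐ[volume.restrict Ω] magneticGrad h ζ φ j := fun j =>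
    ((continuous_magneticGrad hφs j).memLp_of_hasCompactSupport
      (hasCompactSupport_magneticGrad hφc j)).coeFn_toLp
  have hXbdry : X.bdry =ᵐ[arcLength Ω] φ :=
    (hφs.continuous.memLp_of_hasCompactSupport hφc).coeFn_toLp
  have key := hlam.le_form hh0 (hform h ⟨hh0, hh1⟩ ζ) (Submodule.le_topologicalClosure _ hXmem)
  have hac' := has.continuous
  have hbc' := hbs.continuous
  have hda := has.continuous_deriv (by simp)
  have hdb := hbs.continuous_deriv (by simp)
  set A := ∫ s, a s ^ 2 with hA
  have I0 : ∀ a b : ℝ → ℝ, Continuous a → Continuous b → (∀ s, R ≤ |s| → a s = 0) →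
      (∀ s, R ≤ |s| → b s = 0) → _ := fun a b ha hb haR hbR =>
    hc.setLIntegral_prod_le hΩ.isOpen hn hσ hη hηc.1.le hηR hσr ha hb haR hbR
  have J0 := I0 a b hac' hbc' (fun s hs => (hR₁ s hs).1) (fun s hs => (hR₂ s hs).1)
  have J1 := I0 a (deriv b) hac' hdb (fun s hs => (hR₁ s hs).1) (fun s hs => (hR₂ s hs).2)
  have J2 := I0 (deriv a) b hda hbc' (fun s hs => (hR₁ s hs).2) (fun s hs => (hR₂ s hs).1)
  rw [hσ2] at J0 J1 J2
  have hU : ‖X.fn‖ ^ 2 ≤ h * (A * ((1 + δ) / 2)) := by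
    rw [← ENNReal.ofReal_le_ofReal_iff (by positivity), ofReal_norm_sq, lintegral_congr_ae
      (g := fun x => ENNReal.ofReal (‖φ x‖ ^ 2)) (by filter_upwards [hXfn] with x hx; rw [hx])]
    simp_rw [hφn]
    refine J0.trans (ENNReal.ofReal_le_ofReal ?_)
    gcongr
  have hN : ∑ j, ‖X.grad j‖ ^ 2 ≤ h * (h * (A * ((1 + δ) / 2))) + h * (h * (δ * A * ((1 + δ) / 2)))
      + δ * h * (h * (A * ((1 + δ) / 2))) := by
    rw [← ENNReal.ofReal_le_ofReal_iff (by positivity),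
      ENNReal.ofReal_sum_of_nonneg fun _ _ => sq_nonneg _]
    simp_rw [ofReal_norm_sq]
    have hmeas : ∀ j, Measurable fun x => ENNReal.ofReal (‖magneticGrad h ζ φ j x‖ ^ 2) := fun j =>
      by have := (continuous_magneticGrad (h := h) (ζ := ζ) hφs j).measurable; fun_prop
    rw [Finset.sum_congr rfl fun j _ => lintegral_congr_ae
      (g := fun x => ENNReal.ofReal (‖magneticGrad h ζ φ j x‖ ^ 2))
      (by filter_upwards [hXgrad j] with x hx; rw [hx]), ← lintegral_finsetSum _ fun j _ => hmeas j]
    have ht : Continuous (tangential p n) := continuous_tangential p n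
    refine (lintegral_mono fun x => ?_).trans (b := ∫⁻ x in Ω,
      (ENNReal.ofReal h * ENNReal.ofReal
        (a (σ⁻¹ * tangential p n x) ^ 2 * deriv b (σ⁻¹ * inner ℝ n (x - p)) ^ 2)
      + ENNReal.ofReal h * ENNReal.ofReal
        (deriv a (σ⁻¹ * tangential p n x) ^ 2 * b (σ⁻¹ * inner ℝ n (x - p)) ^ 2))
      + ENNReal.ofReal (δ * h) * ENNReal.ofReal
        (a (σ⁻¹ * tangential p n x) ^ 2 * b (σ⁻¹ * inner ℝ n (x - p)) ^ 2)) ?_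
    · rw [← ENNReal.ofReal_sum_of_nonneg fun _ _ => sq_nonneg _,
        ← ENNReal.ofReal_mul (by positivity), ← ENNReal.ofReal_mul (by positivity),
        ← ENNReal.ofReal_mul (by positivity), ← ENNReal.ofReal_add (by positivity) (by positivity),
        ← ENNReal.ofReal_add (by positivity) (by positivity)]
      exact ENNReal.ofReal_le_ofReal (hGn x)
    · rw [lintegral_add_right _ (Measurable.const_mul (Measurable.ennreal_ofReal
          (Continuous.measurable (by fun_prop))) _),
        lintegral_add_right _ (Measurable.const_mul (Measurable.ennreal_ofReal
          (Continuous.measurable (by fun_prop))) _),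
        lintegral_const_mul' _ _ ENNReal.ofReal_ne_top,
        lintegral_const_mul' _ _ ENNReal.ofReal_ne_top,
        lintegral_const_mul' _ _ ENNReal.ofReal_ne_top,
        ENNReal.ofReal_add (by positivity) (by positivity),
        ENNReal.ofReal_add (by positivity) (by positivity),
        ENNReal.ofReal_mul (p := h) (by positivity),
        ENNReal.ofReal_mul (p := h) (q := h * (δ * A * ((1 + δ) / 2))) (by positivity),
        ENNReal.ofReal_mul (p := δ * h) (by positivity)]
      gcongr
      · exact J1.trans (ENNReal.ofReal_le_ofReal (by gcongr))
      · refine J2.trans (ENNReal.ofReal_le_ofReal ?_)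
        have : 0 ≤ ∫ t in Set.Ioi (-η), b t ^ 2 := integral_nonneg fun _ => sq_nonneg _
        gcongr
      · exact J0.trans (ENNReal.ofReal_le_ofReal (by gcongr))
  have hB : (1 - δ) * (σ * A) ≤ ‖X.bdry‖ ^ 2 := by
    rw [← ENNReal.ofReal_le_ofReal_iff (sq_nonneg _), ofReal_norm_sq, lintegral_congr_ae
      (g := fun x => ENNReal.ofReal (‖φ x‖ ^ 2)) (by filter_upwards [hXbdry] with x hx; rw [hx])]
    simp_rw [hφn]
    exact hc.le_lintegral_arcLength hn hσ hηc hηR hR hσr hac' (fun s hs => (hR₁ s hs).1)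
      (by linarith) hbm
  -- the quotient of the form by `‖φ‖²` is at most `-(1 - 8 δ) h`, by `hU`, `hN` and `hB`
  by_contra hcon
  rw [not_le] at hcon
  have h1 : -((1 - 8 * δ) * h) * ‖X.fn‖ ^ 2 ≤ lam * ‖X.fn‖ ^ 2 :=
    mul_le_mul_of_nonneg_right hcon.le (sq_nonneg _)
  have h2 : ((1 - 8 * δ) * h) * ‖X.fn‖ ^ 2 ≤ ((1 - 8 * δ) * h) * (h * (A * ((1 + δ) / 2))) :=
    mul_le_mul_of_nonneg_left hU (mul_nonneg (by linarith) hh0.le)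
  have h3 : h * σ * ((1 - δ) * (σ * A)) ≤ h * σ * ‖X.bdry‖ ^ 2 :=
    mul_le_mul_of_nonneg_left hB (by positivity)
  have h4 : h * σ * ((1 - δ) * (σ * A)) = h ^ 2 * A * (1 - δ) := by
    calc _ = h * σ ^ 2 * A * (1 - δ) := by ring
      _ = _ := by rw [hσ2]; ring
  rw [hκ] at key
  have h5 : 0 < h ^ 2 * A * (δ + 3 * δ ^ 2) := by positivity
  nlinarith

end GroundStateEnergy

/-! ### Smooth weights -/

section Weights

open ContinuousLinearMap in
open scoped Convolution in
/-- Mollification of a bounded Lipschitz function, which keeps the Lipschitz constant. -/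
theorem exists_contDiff_lipschitz_approx {g : Plane → ℝ} (hg : LipschitzWith 1 g) {M ρ : ℝ}
    (hρ : 0 < ρ) (hM : ∀ x, |g x| ≤ M) :
    ∃ d : Plane → ℝ, ContDiff ℝ ∞ d ∧ LipschitzWith 1 d ∧
      ∀ x r, (∀ y ∈ Metric.ball x ρ, |g y - g x| ≤ r) → |d x - g x| ≤ r := by
  let φ : ContDiffBump (0 : Plane) := ⟨ρ / 2, ρ, half_pos hρ, half_lt_self hρ⟩
  have hgi : LocallyIntegrable g := hg.continuous.locallyIntegrable
  have hint : ∀ x, Integrable fun t => φ.normed volume t * g (x - t) := fun x =>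
    (φ.integrable_normed (μ := volume)).mul_bdd (c := M)
      (hg.continuous.comp (continuous_const.sub continuous_id)).aestronglyMeasurable
      (Eventually.of_forall fun t => hM _)
  refine ⟨φ.normed volume ⋆[lsmul ℝ ℝ, volume] g,
    φ.hasCompactSupport_normed.contDiff_convolution_left _ φ.contDiff_normed hgi, ?_, ?_⟩
  · refine LipschitzWith.of_dist_le_mul fun x y => ?_
    have e : ∀ z, (φ.normed volume ⋆[lsmul ℝ ℝ, volume] g) z =
        ∫ t, φ.normed volume t * g (z - t) := fun z => rfl
    rw [Real.dist_eq, e, e, ← integral_sub (hint x) (hint y), ← Real.norm_eq_abs]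
    have h1 : Integrable fun t => φ.normed volume t * dist x y :=
      (φ.integrable_normed (μ := volume)).mul_const _
    refine (norm_integral_le_of_norm_le h1 (Eventually.of_forall fun t => ?_)).trans (le_of_eq ?_)
    · rw [← mul_sub, norm_mul, Real.norm_of_nonneg (φ.nonneg_normed t)]
      refine mul_le_mul_of_nonneg_left ?_ (φ.nonneg_normed t)
      have := hg.dist_le_mul (x - t) (y - t)
      rwa [dist_sub_right, NNReal.coe_one, one_mul, Real.dist_eq, ← Real.norm_eq_abs] at this
    · rw [integral_mul_const, φ.integral_normed, NNReal.coe_one]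
  · intro x r h
    exact φ.dist_normed_convolution_le hg.continuous.aestronglyMeasurable h

/-- A smooth bounded substitute of the distance to `F`, which vanishes on `F`, has gradient at most
one, and is at least the distance, truncated at height `K`, up to an error `2ρ`. -/
theorem exists_smooth_truncated_dist (F : Set Plane) {ρ K : ℝ} (hρ : 0 < ρ) (hK : 0 ≤ K) :
    ∃ d : Plane → ℝ, ContDiff ℝ ∞ d ∧ LipschitzWith 1 d ∧ (∀ x ∈ F, d x = 0) ∧
      (∃ M, ∀ x, |d x| ≤ M) ∧ ∀ x, min (Metric.infDist x F) K ≤ d x + 2 * ρ := by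
  set g : Plane → ℝ := fun x => min (max (Metric.infDist x F - ρ) 0) K with hg
  have hgL : LipschitzWith 1 g := by
    have h1 : LipschitzWith 1 fun x => Metric.infDist x F - ρ := by
      refine LipschitzWith.of_dist_le_mul fun x y => ?_
      rw [dist_sub_right]
      exact (Metric.lipschitz_infDist_pt F).dist_le_mul x y
    exact (h1.max_const 0).min_const K
  have hg0 : ∀ x, 0 ≤ g x := fun x => le_min (le_max_right _ _) hK
  have hgK : ∀ x, g x ≤ K := fun x => min_le_right _ _
  obtain ⟨d, hd, hdL, hdg⟩ := exists_contDiff_lipschitz_approx hgL hρ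
    (M := K) fun x => abs_le.2 ⟨by linarith [hg0 x], hgK x⟩
  have hclose : ∀ x, |d x - g x| ≤ ρ := fun x => hdg x ρ fun y hy => by
    have := hgL.dist_le_mul y x
    rw [NNReal.coe_one, one_mul, Real.dist_eq] at this
    exact this.trans (Metric.mem_ball.1 hy).le
  refine ⟨d, hd, hdL, fun x hx => ?_, ⟨K + ρ, fun x => ?_⟩, fun x => ?_⟩
  · have hzero : ∀ y ∈ Metric.ball x ρ, g y = 0 := fun y hy => by
      have h1 : Metric.infDist y F ≤ ρ :=
        (Metric.infDist_le_dist_of_mem hx).trans (Metric.mem_ball.1 hy).le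
      simp only [hg]
      rw [max_eq_right (by linarith), min_eq_left hK]
    have h2 := hdg x 0 fun y hy => by
      rw [hzero y hy, hzero x (Metric.mem_ball_self hρ), sub_self, abs_zero]
    rw [hzero x (Metric.mem_ball_self hρ), sub_zero] at h2
    exact abs_nonpos_iff.1 h2
  · have h1 := abs_le.1 (hclose x)
    rw [abs_le]
    constructor <;> linarith [hg0 x, hgK x, h1.1, h1.2]
  · have h1 := (abs_le.1 (hclose x)).1
    have h2 : min (Metric.infDist x F) K ≤ g x + ρ := by
      simp only [hg]
      rw [← min_add_add_right]
      exact min_le_min (by linarith [le_max_left (Metric.infDist x F - ρ) 0]) (by linarith)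
    linarith

/-- The weight `Φ(τ d)` and its partial derivatives, as bounded continuous functions. -/
theorem exists_weight {d : Plane → ℝ} (hd : ContDiff ℝ ∞ d) (hdL : LipschitzWith 1 d)
    (hdM : ∃ M, ∀ x, |d x| ≤ M) {Φ : ℝ → ℝ} (hΦ : ContDiff ℝ ∞ Φ) (τ : ℝ) :
    ∃ (w : BoundedContinuousFunction Plane ℝ) (dw : Fin 2 → BoundedContinuousFunction Plane ℝ),
      (∀ x, w x = Φ (τ * d x)) ∧ ContDiff ℝ ∞ w ∧
      (∀ j x, fderiv ℝ w x (EuclideanSpace.single j 1) = dw j x) ∧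
      ∀ x, ∑ j, dw j x ^ 2 ≤ (τ * deriv Φ (τ * d x)) ^ 2 := by
  obtain ⟨M, hM⟩ := hdM
  have hbd : ∀ {Ψ : ℝ → ℝ}, Continuous Ψ → ∃ C, ∀ x, |Ψ (τ * d x)| ≤ C := fun {Ψ} hΨ => by
    obtain ⟨C, hC⟩ := (isCompact_Icc (a := -(|τ| * M)) (b := |τ| * M)).exists_bound_of_continuousOn
      hΨ.continuousOn
    refine ⟨C, fun x => hC _ (abs_le.1 ?_)⟩
    rw [abs_mul]
    exact mul_le_mul_of_nonneg_left (hM x) (abs_nonneg _)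
  have hw : ContDiff ℝ ∞ fun x => Φ (τ * d x) := hΦ.comp (contDiff_const.mul hd)
  have hfd : ∀ x, fderiv ℝ (fun x => Φ (τ * d x)) x = (deriv Φ (τ * d x) * τ) • fderiv ℝ d x :=
    fun x => by
      have h1 := (hd.differentiable (by simp) x).hasFDerivAt.const_mul τ
      have h2 := (hΦ.differentiable (by simp) (τ * d x)).hasDerivAt.comp_hasFDerivAt x h1
      rw [HasFDerivAt.fderiv (f := fun x => Φ (τ * d x)) h2, smul_smul]
  have hL : ∀ x, ∑ j : Fin 2, (fderiv ℝ d x (EuclideanSpace.single j 1)) ^ 2 ≤ 1 := fun x => by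
    set L := fderiv ℝ d x
    have h1 : ‖L‖ ≤ 1 := by simpa using norm_fderiv_le_of_lipschitz ℝ hdL (x₀ := x)
    set v : Plane := (InnerProductSpace.toDual ℝ Plane).symm L with hv
    have hvn : ‖v‖ = ‖L‖ := LinearIsometryEquiv.norm_map _ _
    have hvL : ∀ y, L y = inner ℝ v y := fun y => (InnerProductSpace.toDual_symm_apply).symm
    simp_rw [hvL, EuclideanSpace.inner_single_right]
    rw [Fin.sum_univ_two]
    have h2 := norm_sq_plane v
    simp only [one_mul, conj_trivial]
    rw [← h2, hvn]
    exact pow_le_one₀ (norm_nonneg _) h1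
  obtain ⟨C, hC⟩ := hbd hΦ.continuous
  obtain ⟨C', hC'⟩ := hbd (hΦ.continuous_deriv (by simp))
  have hbd' : ∀ j x, ‖fderiv ℝ (fun x => Φ (τ * d x)) x (EuclideanSpace.single j 1)‖ ≤
      C' * |τ| := fun j x => by
    have h1 : |fderiv ℝ d x (EuclideanSpace.single j 1)| ≤ 1 := by
      rw [← sq_le_one_iff_abs_le_one]
      exact (Finset.single_le_sum (f := fun j : Fin 2 =>
        (fderiv ℝ d x (EuclideanSpace.single j 1)) ^ 2) (fun _ _ => sq_nonneg _)
        (Finset.mem_univ j)).trans (hL x)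
    rw [hfd, smul_apply, smul_eq_mul, norm_mul, norm_mul, Real.norm_eq_abs, Real.norm_eq_abs,
      Real.norm_eq_abs]
    calc _ ≤ |deriv Φ (τ * d x)| * |τ| * 1 := by gcongr
      _ ≤ _ := by rw [mul_one]; exact mul_le_mul_of_nonneg_right (hC' x) (abs_nonneg _)
  refine ⟨BoundedContinuousFunction.ofNormedAddCommGroup (fun x => Φ (τ * d x)) hw.continuous C hC,
    fun j => BoundedContinuousFunction.ofNormedAddCommGroup
      (fun x => fderiv ℝ (fun x => Φ (τ * d x)) x (EuclideanSpace.single j 1))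
      ((hw.continuous_fderiv (by simp)).clm_apply continuous_const) _ (hbd' j),
    fun x => rfl, hw, fun j x => rfl, fun x => ?_⟩
  simp only [BoundedContinuousFunction.coe_ofNormedAddCommGroup, hfd, smul_apply, smul_eq_mul,
    mul_pow]
  rw [← Finset.mul_sum]
  have := mul_le_mul_of_nonneg_left (hL x) (by positivity : 0 ≤ deriv Φ (τ * d x) ^ 2 * τ ^ 2)
  linarith

end Weights

/-! ### The Agmon estimate -/

section Agmon

variable {Ω : Set Plane} {h ζ : ℝ}

/-- A pointwise bound of `|∇w|²` by `a + b v²`, integrated against `|f|²`. -/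
theorem sum_norm_sq_mulOp_le {μ : Measure Plane} {f : Lp ℂ 2 μ}
    {dw : Fin 2 → BoundedContinuousFunction Plane ℝ} {v : BoundedContinuousFunction Plane ℝ}
    {a b : ℝ} (hle : ∀ x, ∑ j, dw j x ^ 2 ≤ a + b * v x ^ 2) :
    ∑ j, ‖mulOp μ (dw j) f‖ ^ 2 ≤ a * ‖f‖ ^ 2 + b * ‖mulOp μ v f‖ ^ 2 := by
  simp_rw [norm_sq_mulOp]
  rw [norm_sq_eq_integral, ← integral_const_mul, ← integral_const_mul,
    ← integral_finsetSum _ fun j _ => integrable_sq_mul_norm_sq _ _,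
    ← integral_add ((integrable_norm_sq f).const_mul _)
      ((integrable_sq_mul_norm_sq v f).const_mul _)]
  refine integral_mono (integrable_finsetSum _ fun j _ => integrable_sq_mul_norm_sq _ _)
    (((integrable_norm_sq f).const_mul _).add ((integrable_sq_mul_norm_sq v f).const_mul _))
    fun x => ?_
  change ∑ j, dw j x ^ 2 * ‖f x‖ ^ 2 ≤ a * ‖f x‖ ^ 2 + b * (v x ^ 2 * ‖f x‖ ^ 2)
  rw [← Finset.sum_mul]
  have := mul_le_mul_of_nonneg_right (hle x) (sq_nonneg ‖f x‖)
  linarith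

theorem norm_sq_mulOp_of_sq_eq {μ : Measure Plane} {f : Lp ℂ 2 μ}
    {s w : BoundedContinuousFunction Plane ℝ} (hws : ∀ x, w x ^ 2 = s x ^ 2 + 1) :
    ‖mulOp μ w f‖ ^ 2 = ‖f‖ ^ 2 + ‖mulOp μ s f‖ ^ 2 := by
  rw [norm_sq_eq_integral f, norm_sq_mulOp, norm_sq_mulOp, ← integral_add
    (integrable_norm_sq _) (integrable_sq_mul_norm_sq _ _)]
  refine integral_congr_ae (Eventually.of_forall fun y => ?_)
  simp only [hws]
  ring

theorem mulOp_arcLength_eq_zero {s : BoundedContinuousFunction Plane ℝ}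
    (hs : ∀ x ∈ frontier Ω, s x = 0) (g : L2Boundary Ω) : mulOp _ s g = 0 := by
  refine Lp.ext ?_
  filter_upwards [coeFn_mulOp s g, Lp.coeFn_zero ℂ 2 (arcLength Ω),
    ae_restrict_mem (μ := (μH[1] : Measure Plane)) isClosed_frontier.measurableSet]
    with y h1 h2 h3
  rw [h1, h2, hs y h3]
  simp

theorem norm_sq_mulOp_grad_le (hh : 0 ≤ h) (x : TripleSpace Ω)
    (w : BoundedContinuousFunction Plane ℝ) (dw : Fin 2 → BoundedContinuousFunction Plane ℝ)
    (j : Fin 2) : ‖mulOp _ w (x.grad j)‖ ^ 2 ≤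
      2 * ‖(mulTriple h w dw x).grad j‖ ^ 2 + 2 * (h ^ 2 * ‖mulOp _ (dw j) x.fn‖ ^ 2) := by
  have e3 : mulOp _ w (x.grad j) =
      (mulTriple h w dw x).grad j - (h : ℂ) • mulOp _ (dw j) x.fn := by
    simp [mulTriple]
  have h1 := norm_sub_le ((mulTriple h w dw x).grad j) ((h : ℂ) • mulOp _ (dw j) x.fn)
  rw [← e3, norm_smul, Complex.norm_real, Real.norm_of_nonneg hh] at h1
  have h2 := pow_le_pow_left₀ (norm_nonneg _) h1 2
  have h3 := sq_nonneg (‖(mulTriple h w dw x).grad j‖ - h * ‖mulOp _ (dw j) x.fn‖)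
  linarith

/-- The arithmetic of the Agmon estimate: `S = ‖s u‖²` for the weight `s = sinh (τ d)`, which
vanishes on the boundary, `1 + S` is the squared norm of `cosh (τ d) u`, `N₁` and `N₂` are the
squared norms of the magnetic gradients of the weighted functions, `D₁` and `D₂` those of `∇s u` and
`∇w u`, `B` is the boundary term and `G` the weighted squared norm of the magnetic gradient. -/
theorem agmon_arithmetic {α τ lam K S N₁ N₂ D₁ D₂ B G : ℝ} (hh : 0 < h) (hα : 0 ≤ α)
    (hα1 : α < 1) (hK : 0 ≤ K) (hτ2 : h ^ 2 * τ ^ 2 = α ^ 2 * h)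
    (hlam : lam ≤ -((1 + α ^ 2) / 2 * h)) (hS0 : 0 ≤ S) (hn1 : 0 ≤ N₁)
    (hD₁ : D₁ ≤ τ ^ 2 + τ ^ 2 * S) (hD₂ : D₂ ≤ τ ^ 2 * S)
    (id1 : N₁ = lam * S + h ^ 2 * D₁) (id2 : N₂ - B = lam * (1 + S) + h ^ 2 * D₂)
    (hform : B ≤ 1 / 2 * N₂ + K * h * (1 + S)) (hG : G ≤ 2 * N₂ + 2 * (h ^ 2 * D₂)) :
    1 + S + h⁻¹ * G ≤ (7 + 4 * K) * (1 + 2 * α ^ 2 / (1 - α ^ 2)) := by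
  have hα2 : 0 < 1 - α ^ 2 := by nlinarith
  have hh2 : 0 < h ^ 2 := by positivity
  have hD1 : h ^ 2 * D₁ ≤ α ^ 2 * h * (1 + S) := by
    have := mul_le_mul_of_nonneg_left hD₁ hh2.le
    calc _ ≤ _ := this
      _ = h ^ 2 * τ ^ 2 * (1 + S) := by ring
      _ = _ := by rw [hτ2]
  have hD2 : h ^ 2 * D₂ ≤ α ^ 2 * h * S := by
    have := mul_le_mul_of_nonneg_left hD₂ hh2.le
    calc _ ≤ _ := this
      _ = h ^ 2 * τ ^ 2 * S := by ring
      _ = _ := by rw [hτ2]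
  have hS : S ≤ 2 * α ^ 2 / (1 - α ^ 2) := by
    rw [le_div_iff₀ hα2]
    have h1 := mul_le_mul_of_nonneg_right hlam hS0
    have h2 : 0 ≤ h * (2 * α ^ 2 - S * (1 - α ^ 2)) := by linarith
    have := nonneg_of_mul_nonneg_right h2 hh
    linarith
  have hlam0 : lam * (1 + S) ≤ 0 := mul_nonpos_of_nonpos_of_nonneg
    (hlam.trans (neg_nonpos.2 (by positivity))) (by linarith)
  have hα2h : α ^ 2 * h * S ≤ h * S := by
    have := mul_nonneg (mul_nonneg hα2.le hh.le) hS0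
    linarith
  have hG : G ≤ h * (6 * S + 4 * (K * (1 + S))) := by linarith
  have hG' : h⁻¹ * G ≤ 6 * S + 4 * (K * (1 + S)) := by
    rwa [inv_mul_le_iff₀ hh]
  have h7 : (7 + 4 * K) * (1 + S) ≤ (7 + 4 * K) * (1 + 2 * α ^ 2 / (1 - α ^ 2)) :=
    mul_le_mul_of_nonneg_left (by linarith) (by linarith)
  linarith

/-- The weighted estimate with the hyperbolic cosine of a smooth function `d` which vanishes on the
boundary. The weight `w = sinh (τ d)` vanishes there and satisfies `h² |∇w|² ≤ α² h (1 + w²)`, so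
the Agmon identity bounds `‖w u‖`; the form bound of the boundary term then gives the gradient. -/
theorem norm_cosh_le [IsFiniteMeasure (arcLength Ω)] (hh : 0 < h) {x : TripleSpace Ω}
    (hx : x ∈ formDomain Ω h ζ) (hnorm : ‖x.fn‖ = 1) {lam α K : ℝ} (hα : 0 ≤ α) (hα1 : α < 1)
    (hK : 0 ≤ K)
    (heq : ∀ (v : L2 Ω) (Gv : Fin 2 → L2 Ω) (gv : L2Boundary Ω),
      IsMagneticGrad Ω h ζ v Gv → IsTrace Ω h ζ v Gv gv →
        robinForm h x.grad x.bdry Gv gv = inner ℂ v ((lam : ℂ) • x.fn))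
    (hlam : lam ≤ -((1 + α ^ 2) / 2 * h))
    (hform : ∀ y ∈ formDomain Ω h ζ, h ^ (3 / 2 : ℝ) * ‖y.bdry‖ ^ 2 ≤
      1 / 2 * ∑ j, ‖y.grad j‖ ^ 2 + K * h * ‖y.fn‖ ^ 2)
    {d : Plane → ℝ} (hd : ContDiff ℝ ∞ d) (hdL : LipschitzWith 1 d)
    (hdM : ∃ M, ∀ x, |d x| ≤ M) (hd0 : ∀ x ∈ frontier Ω, d x = 0) :
    ∃ w : BoundedContinuousFunction Plane ℝ, (∀ x, w x = Real.cosh (α / Real.sqrt h * d x)) ∧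
      ‖mulOp _ w x.fn‖ ^ 2 + h⁻¹ * ∑ j, ‖mulOp _ w (x.grad j)‖ ^ 2 ≤
        (7 + 4 * K) * (1 + 2 * α ^ 2 / (1 - α ^ 2)) := by
  set τ := α / Real.sqrt h with hτ
  have hτ2 : h ^ 2 * τ ^ 2 = α ^ 2 * h := by
    rw [hτ, div_pow, Real.sq_sqrt hh.le]
    field_simp
  obtain ⟨s, ds, hs, hsc, hds, hdsle⟩ := exists_weight hd hdL hdM Real.contDiff_sinh τ
  obtain ⟨w, dw, hw, hwc, hdw, hdwle⟩ := exists_weight hd hdL hdM Real.contDiff_cosh τ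
  have hds' : ∑ j, ‖mulOp _ (ds j) x.fn‖ ^ 2 ≤ τ ^ 2 * ‖x.fn‖ ^ 2 + τ ^ 2 * ‖mulOp _ s x.fn‖ ^ 2 :=
    sum_norm_sq_mulOp_le fun y => (hdsle y).trans (le_of_eq (by
      rw [Real.deriv_sinh, hs, mul_pow, Real.cosh_sq]; ring))
  have hdw' : ∑ j, ‖mulOp _ (dw j) x.fn‖ ^ 2 ≤ 0 * ‖x.fn‖ ^ 2 + τ ^ 2 * ‖mulOp _ s x.fn‖ ^ 2 :=
    sum_norm_sq_mulOp_le fun y => (hdwle y).trans (le_of_eq (by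
      rw [Real.deriv_cosh, hs, mul_pow]; ring))
  have hws : ‖mulOp _ w x.fn‖ ^ 2 = ‖x.fn‖ ^ 2 + ‖mulOp _ s x.fn‖ ^ 2 :=
    norm_sq_mulOp_of_sq_eq fun y => by rw [hw, hs, Real.cosh_sq]
  have hsb : mulOp _ s x.bdry = 0 :=
    mulOp_arcLength_eq_zero (fun y hy => by rw [hs, hd0 y hy, mul_zero, Real.sinh_zero]) _
  have id1 := agmon_identity hx heq hsc hds
  have id2 := agmon_identity hx heq hwc hdw
  rw [hsb, norm_zero, zero_pow two_ne_zero, mul_zero, sub_zero] at id1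
  have hform2 := hform _ (mulTriple_mem hwc hdw hx)
  rw [show (mulTriple h w dw x).bdry = mulOp _ w x.bdry from rfl,
    show (mulTriple h w dw x).fn = mulOp _ w x.fn from rfl] at hform2
  have hy := Finset.sum_le_sum fun j (_ : j ∈ Finset.univ) =>
    norm_sq_mulOp_grad_le hh.le x w dw j
  rw [Finset.sum_add_distrib, ← Finset.mul_sum, ← Finset.mul_sum, ← Finset.mul_sum] at hy
  refine ⟨w, hw, ?_⟩
  rw [hnorm, one_pow] at hws hds' hdw'
  rw [hws] at id2 hform2 ⊢
  rw [mul_one] at hds'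
  rw [zero_mul, zero_add] at hdw'
  exact agmon_arithmetic hh hα hα1 hK hτ2 hlam (sq_nonneg _)
    (Finset.sum_nonneg fun _ _ => sq_nonneg _) hds' hdw' id1 id2 hform2 hy

theorem exp_le_four_mul_cosh_sq (y : ℝ) : Real.exp (2 * y) ≤ 4 * Real.cosh y ^ 2 := by
  have h1 : Real.exp y ≤ 2 * Real.cosh y := by
    rw [Real.cosh_eq]; linarith [Real.exp_pos (-y)]
  have h2 : Real.exp (2 * y) = Real.exp y ^ 2 := by rw [← Real.exp_nat_mul]; norm_num
  rw [h2]
  nlinarith [Real.exp_pos y]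

end Agmon

end RobinMagnetic

open RobinMagnetic TripleSpace in
theorem theorem3p5 (Ω : Set RobinMagnetic.Plane) (hΩ : RobinMagnetic.IsC3Domain Ω)
    (c₁ c₂ ε α : ℝ) (hc₁ : 0 < c₁) (hc₂ : c₁ < c₂) (hε : 0 < ε) (hα : α < 1) :
    ∃ C : ℝ, 0 < C ∧ ∃ h₀ ∈ Set.Ioo (0 : ℝ) 1,
      ∀ h ∈ Set.Ioo (0 : ℝ) h₀, ∀ ζ ∈ Set.Ioo (c₁ * h ^ ε) (c₂ * h ^ ε),
        ∀ u : RobinMagnetic.L2 Ω, RobinMagnetic.IsNormalizedGroundState Ω h ζ u →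
          ∀ G : Fin 2 → RobinMagnetic.L2 Ω, RobinMagnetic.IsMagneticGrad Ω h ζ u G →
            ∫⁻ x in Ω, ENNReal.ofReal
              ((‖u x‖ ^ 2 + h⁻¹ * ∑ j : Fin 2, ‖G j x‖ ^ 2) *
                Real.exp (2 * α * Metric.infDist x (frontier Ω) / Real.sqrt h))
              ≤ ENNReal.ofReal C := by
  -- the integrand increases with `α`
  set β := max α (1 / 2) with hβ
  have hβ0 : 0 < β := lt_max_of_lt_right (by norm_num)
  have hβ1 : β < 1 := max_lt hα (by norm_num)
  have hβ2 : 0 < 1 - β ^ 2 := by nlinarith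
  have hβ4 : 1 / 4 ≤ β ^ 2 := by nlinarith [le_max_right α (1 / 2)]
  have := hΩ.isFiniteMeasure_arcLength
  obtain ⟨K, hK, hform⟩ := hΩ.exists_form_bound
  -- `δ` is such that `1 - 8 δ` lies half way between `β²` and `1`
  obtain ⟨h₀, hh₀, hlow⟩ := hΩ.groundStateEnergy_le (δ := (1 - β ^ 2) / 16) (c := c₂) (ε := ε)
    (by linarith) (by linarith) hε
  set C₀ := (7 + 4 * K) * (1 + 2 * β ^ 2 / (1 - β ^ 2)) with hC₀
  have hC₀0 : 0 < C₀ := by positivity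
  refine ⟨4 * Real.exp (4 * β) * C₀, by positivity, h₀, hh₀, fun h hh ζ hζ u hu G hG => ?_⟩
  have hh0 : 0 < h := hh.1
  have hσ : 0 < Real.sqrt h := Real.sqrt_pos.2 hh0
  obtain ⟨hu1, lam, hlam, Gu, gu, hGu, htr, heq⟩ := hu
  obtain rfl : G = Gu := hG.unique hΩ.isOpen hGu
  have hlamle := hlow h hh ζ ⟨(by positivity : 0 < c₁ * h ^ ε).trans hζ.1, hζ.2⟩ lam hlam
  have hx : TripleSpace.mk u G gu ∈ formDomain Ω h ζ := (mk_mem_formDomain_iff _ _ _).2 htr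
  have hint : ∀ x, 0 ≤ ‖u x‖ ^ 2 + h⁻¹ * ∑ j : Fin 2, ‖G j x‖ ^ 2 := fun x => by positivity
  -- the estimate with the truncated distance
  have htrunc : ∀ m : ℕ, ∫⁻ x in Ω, ENNReal.ofReal ((‖u x‖ ^ 2 + h⁻¹ * ∑ j : Fin 2, ‖G j x‖ ^ 2) *
      Real.exp (2 * β * min (Metric.infDist x (frontier Ω)) m / Real.sqrt h)) ≤
      ENNReal.ofReal (4 * Real.exp (4 * β) * C₀) := fun m => by
    -- smoothing at the scale `√h` costs a factor `exp (4 β)`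
    obtain ⟨d, hd, hdL, hd0, hdM, hdle⟩ :=
      exists_smooth_truncated_dist (frontier Ω) hσ (Nat.cast_nonneg m)
    obtain ⟨w, hw, hwle⟩ := norm_cosh_le hh0 hx hu1 hβ0.le hβ1 hK heq (by linarith)
      (hform h ⟨hh0, hh.2.trans hh₀.2⟩ ζ) hd hdL hdM hd0
    simp only [fn_mk, grad_mk] at hwle
    have hi : Integrable (fun x => w x ^ 2 * ‖u x‖ ^ 2 + h⁻¹ * ∑ j, w x ^ 2 * ‖G j x‖ ^ 2)
        (volume.restrict Ω) := (integrable_sq_mul_norm_sq w u).add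
      ((integrable_finsetSum _ fun j _ => integrable_sq_mul_norm_sq w (G j)).const_mul _)
    have hI : ∫ x in Ω, (w x ^ 2 * ‖u x‖ ^ 2 + h⁻¹ * ∑ j, w x ^ 2 * ‖G j x‖ ^ 2) ≤ C₀ := by
      rw [integral_add (integrable_sq_mul_norm_sq w u)
        ((integrable_finsetSum _ fun j _ => integrable_sq_mul_norm_sq w (G j)).const_mul _),
        integral_const_mul, integral_finsetSum _ fun j _ => integrable_sq_mul_norm_sq w (G j)]
      simpa only [norm_sq_mulOp] using hwle
    calc _ ≤ ∫⁻ x in Ω, ENNReal.ofReal (4 * Real.exp (4 * β)) *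
          ENNReal.ofReal (w x ^ 2 * ‖u x‖ ^ 2 + h⁻¹ * ∑ j, w x ^ 2 * ‖G j x‖ ^ 2) := by
          refine lintegral_mono fun x => ?_
          rw [← ENNReal.ofReal_mul (by positivity)]
          refine ENNReal.ofReal_le_ofReal ?_
          have h1 : 2 * β * min (Metric.infDist x (frontier Ω)) m / Real.sqrt h ≤
              4 * β + 2 * (β / Real.sqrt h * d x) := by
            have h2 := mul_le_mul_of_nonneg_left (hdle x) (by positivity : 0 ≤ 2 * β)
            rw [div_le_iff₀ hσ]
            refine h2.trans (le_of_eq ?_)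
            field_simp
            ring
          have h3 : Real.exp (2 * β * min (Metric.infDist x (frontier Ω)) m / Real.sqrt h) ≤
              4 * Real.exp (4 * β) * w x ^ 2 := by
            refine (Real.exp_le_exp.2 h1).trans ?_
            rw [Real.exp_add, hw]
            nlinarith [exp_le_four_mul_cosh_sq (β / Real.sqrt h * d x), Real.exp_pos (4 * β)]
          refine (mul_le_mul_of_nonneg_left h3 (hint x)).trans (le_of_eq ?_)
          rw [← Finset.mul_sum]
          ring
      _ = ENNReal.ofReal (4 * Real.exp (4 * β)) * ENNReal.ofReal
          (∫ x in Ω, (w x ^ 2 * ‖u x‖ ^ 2 + h⁻¹ * ∑ j, w x ^ 2 * ‖G j x‖ ^ 2)) := by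
          rw [lintegral_const_mul' _ _ ENNReal.ofReal_ne_top,
            ofReal_integral_eq_lintegral_ofReal hi (Eventually.of_forall fun x => by positivity)]
      _ ≤ _ := by
          rw [← ENNReal.ofReal_mul (by positivity)]
          exact ENNReal.ofReal_le_ofReal (mul_le_mul_of_nonneg_left hI (by positivity))
  -- monotone convergence, as the truncation is removed
  have hmeas : ∀ m : ℕ, AEMeasurable (fun x => ENNReal.ofReal
      ((‖u x‖ ^ 2 + h⁻¹ * ∑ j : Fin 2, ‖G j x‖ ^ 2) *
      Real.exp (2 * β * min (Metric.infDist x (frontier Ω)) m / Real.sqrt h)))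
      (volume.restrict Ω) := fun m => by
    have h1 : Measurable fun x => u x := (Lp.stronglyMeasurable u).measurable
    have h2 : ∀ j, Measurable fun x => G j x := fun j => (Lp.stronglyMeasurable (G j)).measurable
    have h3 : Measurable fun x : Plane => Metric.infDist x (frontier Ω) :=
      (Metric.continuous_infDist_pt _).measurable
    exact Measurable.aemeasurable (by fun_prop)
  have hlim := lintegral_tendsto_of_tendsto_of_monotone hmeas
    (F := fun x => ENNReal.ofReal ((‖u x‖ ^ 2 + h⁻¹ * ∑ j : Fin 2, ‖G j x‖ ^ 2) *
      Real.exp (2 * β * Metric.infDist x (frontier Ω) / Real.sqrt h)))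
    (Eventually.of_forall fun x m m' hmm' => by
      have := hint x
      have : (m : ℝ) ≤ m' := by exact_mod_cast hmm'
      dsimp only
      gcongr)
    (Eventually.of_forall fun x => by
      refine tendsto_const_nhds.congr' ?_
      filter_upwards [eventually_ge_atTop ⌈Metric.infDist x (frontier Ω)⌉₊] with m hm
      rw [min_eq_left (Nat.ceil_le.1 hm)])
  refine (lintegral_mono fun x => ?_).trans (le_of_tendsto' hlim htrunc)
  refine ENNReal.ofReal_le_ofReal (mul_le_mul_of_nonneg_left (Real.exp_le_exp.2 ?_) (hint x))
  have h1 : 0 ≤ Metric.infDist x (frontier Ω) := Metric.infDist_nonneg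
  gcongr
  exact le_max_left _ _
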